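/- Conventions. For $n\in\mathbb N=\{1,2,\dots\}$ let $\mathcal U_{nc}(n)$ be the universal unital $C^*$-algebra generated by elements $u_{ij}$ ($1\le i,j\le n$) such that the matrix $(u_{ij})$ is unitary, and let $\mathcal V_n=\operatorname{span}(\{1\}\cup\{u_{ij}\}\cup\{u_{ij}^*\})\subseteq\mathcal U_{nc}(n)$, an operator system. For operator systems $\mathcal S,\mathcal T$, the minimal tensor product $\mathcal S\otimes_{\min}\mathcal T$ is $\mathcal S\otimes\mathcal T$ with unit $1\otimes 1$ and with $X=X^*\in M_k(\mathcal S\otimes\mathcal T)$ positive if and only if $(\varphi\otimes\psi)^{(k)}(X)\ge 0$ for all $r,q$ and all unital completely positive (ucp) maps $\varphi:\mathcal S\to M_r$, $\psi:\mathcal T\to M_q$. The maximal tensor product $\mathcal S\otimes_{\max}\mathcal T$ is $\mathcal S\otimes\mathcal T$ with unit $1\otimes1$ and with $X=X^*\in M_k(\mathcal S\otimes\mathcal T)$ positive if and only if for every $\varepsilon>0$ one can write $X+\varepsilon\, I_k\otimes(1\otimes 1)=A(P\otimes Q)A^*$ with $P\in M_a(\mathcal S)_+$, $Q\in M_b(\mathcal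 T)_+$ and a scalar $k\times ab$ matrix $A$. An operator system $\mathcal S$ has property $\mathfrak V_n$ if whenever $p\in\mathbb N$ and $S_{11}$, $S_{i,n+j}$, $S_{n+i,j}\in M_p(\mathcal S)$ ($1\le i,j\le n$) satisfy $$1\otimes S_{11}+\sum_{i,j=1}^n\tfrac1{2n}u_{ij}\otimes S_{i,n+j}+\sum_{i,j=1}^n\tfrac1{2n}u_{ji}^*\otimes S_{n+i,j}\in(\mathcal U_{nc}(n)\otimes_{\min}M_p(\mathcal S))_+,$$ then for every $\varepsilon>0$ there is a positive $R=(R_{kl})_{k,l=1}^{2n}\in M_{2n}(M_p(\mathcal S))$ with $R_{i,n+j}=S_{i,n+j}$ and $R_{n+i,j}=S_{n+i,j}$ for all $1\le i,j\le n$, and $\sum_{k=1}^{2n}R_{kk}=2n(S_{11}+\varepsilon 1)$. (The entry $S_{11}$ is a separate datum, not one of the off-diagonal block entries, also when $n=1$.) It has property $\mathfrak V$ if it has property $\mathfrak V_n$ for every $n\in\mathbb N$. An operator system $\mathcal S$ has the operator system local lifting property (OSLLP) if for every unital $C^*$-algebra $\mathcal A$, every closed two-sided ideal $\mathcal I$ with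 quotient map $\pi:\mathcal A\to\mathcal A/\mathcal I$, every ucp map $\varphi:\mathcal S\to\mathcal A/\mathcal I$ and every finite-dimensional operator subsystem $\mathcal T\subseteq\mathcal S$, there is a ucp map $\psi:\mathcal T\to\mathcal A$ with $\pi\circ\psi=\varphi|_{\mathcal T}$. Lemma. For every Hilbert space $\mathcal H$, $B(\mathcal H)$ has property $\mathfrak V$; that is, equivalently, $\mathcal V_n\otimes_{\min}B(\mathcal H)=\mathcal V_n\otimes_{\max}B(\mathcal H)$ (the positive cones coincide at all matrix levels) for every $n\in\mathbb N$ and every Hilbert space $\mathcal H$. Equivalently, $\mathcal V_n$ has the OSLLP for every $n\ge2$. All three of these assertions hold. -/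

import Mathlib

open scoped TensorProduct ENNReal Matrix

universe u v

noncomputable section

/-! ### Abstract operator systems -/

/-- The compression `A^* X A` of a matrix `X` over a complex vector space by a rectangular scalar
matrix `A`. -/
def scalarConj {S : Type*} [AddCommGroup S] [Module ℂ S] {ι κ : Type} [Fintype ι]
    (A : Matrix ι κ ℂ) (X : Matrix ι ι S) : Matrix κ κ S :=
  Matrix.of fun i j => ∑ a, ∑ b, (star (A a i) * A b j) • X a b

/-- An abstract operator system: a complex `*`-vector space with a matrix ordering and an
Archimedean matrix order unit.  For convenience the matrix cones are indexed by all finite index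
types instead of only by the sizes `1, 2, 3, …`; by `conj_mem` (applied to the matrices of
bijections) the cone depends on the cardinality of the index type only. -/
class OperatorSystem (S : Type*) [AddCommGroup S] [Module ℂ S] [StarAddMonoid S]
    [StarModule ℂ S] where
  /-- the order unit -/
  unit : S
  /-- the cone of positive elements of the space of `ι × ι` matrices over `S` -/
  cone : ∀ (ι : Type) [Fintype ι], Set (Matrix ι ι S)
  star_unit : star unit = unit
  isHermitian : ∀ {ι : Type} [Fintype ι] {X : Matrix ι ι S}, X ∈ cone ι → Xᴴ = X
  add_mem : ∀ {ι : Type} [Fintype ι] {X Y : Matrix ι ι S},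
    X ∈ cone ι → Y ∈ cone ι → X + Y ∈ cone ι
  smul_mem : ∀ {ι : Type} [Fintype ι] {X : Matrix ι ι S} {t : ℝ},
    0 ≤ t → X ∈ cone ι → (t : ℂ) • X ∈ cone ι
  conj_mem : ∀ {ι κ : Type} [Fintype ι] [Fintype κ] (A : Matrix ι κ ℂ) {X : Matrix ι ι S},
    X ∈ cone ι → scalarConj A X ∈ cone κ
  eq_zero : ∀ {ι : Type} [Fintype ι] {X : Matrix ι ι S}, X ∈ cone ι → -X ∈ cone ι → X = 0
  order_unit : ∀ {ι : Type} [Fintype ι] [DecidableEq ι] (X : Matrix ι ι S), Xᴴ = X →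
    ∃ r : ℝ, 0 < r ∧ X + (r : ℂ) • Matrix.diagonal (fun _ => unit) ∈ cone ι
  archimedean : ∀ {ι : Type} [Fintype ι] [DecidableEq ι] (X : Matrix ι ι S), Xᴴ = X →
    (∀ r : ℝ, 0 < r → X + (r : ℂ) • Matrix.diagonal (fun _ => unit) ∈ cone ι) → X ∈ cone ι

section Maps

variable {S : Type*} [AddCommGroup S] [Module ℂ S] [StarAddMonoid S] [StarModule ℂ S]
  [OperatorSystem S]
  {T : Type*} [AddCommGroup T] [Module ℂ T] [StarAddMonoid T] [StarModule ℂ T]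
  [OperatorSystem T]

/-- Unital completely positive maps. -/
def IsUCP (φ : S →ₗ[ℂ] T) : Prop :=
  φ OperatorSystem.unit = OperatorSystem.unit ∧
    ∀ (ι : Type) [Fintype ι] (X : Matrix ι ι S),
      X ∈ OperatorSystem.cone ι → X.map φ ∈ OperatorSystem.cone (S := T) ι

end Maps

/-! ### Unital C*-algebras as operator systems -/

section CStar

variable {A : Type*} [CStarAlgebra A]

/-- The positive elements of the C*-algebra of `ι × ι` matrices over `A`: the elements of the
form `Y^* Y`. -/
def cstarCone (A : Type*) [CStarAlgebra A] (ι : Type) [Fintype ι] : Set (Matrix ι ι A) :=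
  {X | ∃ Y : Matrix ι ι A, X = Yᴴ * Y}

theorem cstar_nonneg_iff {B : Type*} [CStarAlgebra B] [PartialOrder B] [StarOrderedRing B] (b : B) :
    0 ≤ b ↔ ∃ s, b = star s * s :=
  CStarAlgebra.nonneg_iff_eq_star_mul_self

/-- Positivity in the matrix algebra over `A` is positivity in Mathlib's C*-algebra of matrices. -/
theorem mem_cstarCone_iff [PartialOrder A] [StarOrderedRing A] {ι : Type} [Fintype ι]
    {X : Matrix ι ι A} : X ∈ cstarCone A ι ↔ 0 ≤ CStarMatrix.ofMatrix X := by
  classical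
  refine Iff.trans ?_ (cstar_nonneg_iff (B := CStarMatrix ι ι A) (CStarMatrix.ofMatrix X)).symm
  constructor
  · rintro ⟨Y, rfl⟩
    exact ⟨CStarMatrix.ofMatrix Y, rfl⟩
  · rintro ⟨Y, hY⟩
    exact ⟨CStarMatrix.ofMatrix.symm Y, hY⟩

theorem cstarCone_add_mem {ι : Type} [Fintype ι] {X Y : Matrix ι ι A}
    (hX : X ∈ cstarCone A ι) (hY : Y ∈ cstarCone A ι) : X + Y ∈ cstarCone A ι := by
  let _ := CStarAlgebra.spectralOrder A
  have _ := CStarAlgebra.spectralOrderedRing A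
  rw [mem_cstarCone_iff] at *
  exact add_nonneg hX hY

theorem cstarCone_rect {ι κ : Type} [Fintype ι] [Fintype κ] (Z : Matrix ι κ A) :
    Zᴴ * Z ∈ cstarCone A κ := by
  classical
  rcases isEmpty_or_nonempty κ with h | ⟨⟨k⟩⟩
  · exact ⟨0, Subsingleton.elim _ _⟩
  · have key : ∀ s : Finset ι,
        (Matrix.of fun i j => ∑ a ∈ s, star (Z a i) * Z a j) ∈ cstarCone A κ := by
      intro s
      induction s using Finset.induction_on with
      | empty => exact ⟨0, by ext; simp⟩
      | insert a s ha ih =>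
        have h1 : (Matrix.of fun i j => star (Z a i) * Z a j) ∈ cstarCone A κ := by
          refine ⟨Matrix.of fun c j => if c = k then Z a j else 0, ?_⟩
          ext i j
          simp [Matrix.mul_apply, Matrix.conjTranspose_apply, apply_ite star]
        have h2 := cstarCone_add_mem h1 ih
        convert h2 using 1
        ext i j
        simp [Finset.sum_insert ha]
    have := key Finset.univ
    convert this using 1
    ext i j
    simp [Matrix.mul_apply]

/-- A unital C*-algebra is an operator system. -/
instance CStarAlgebra.operatorSystem : OperatorSystem A where
  unit := 1
  cone ι := cstarCone A ι
  star_unit := star_one A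
  isHermitian := by
    rintro ι _ X ⟨Y, rfl⟩
    simp
  add_mem := cstarCone_add_mem
  smul_mem := by
    rintro ι _ X t ht ⟨Y, rfl⟩
    refine ⟨((Real.sqrt t : ℝ) : ℂ) • Y, ?_⟩
    rw [Matrix.conjTranspose_smul, Matrix.smul_mul, Matrix.mul_smul, smul_smul]
    congr 1
    simp only [RCLike.star_def, Complex.conj_ofReal]
    rw [← Complex.ofReal_mul, Real.mul_self_sqrt ht]
  conj_mem := by
    rintro ι κ _ _ B X ⟨Y, rfl⟩
    have : scalarConj B (Yᴴ * Y) =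
        (Matrix.of fun a j => ∑ b, B b j • Y a b)ᴴ * Matrix.of fun a j => ∑ b, B b j • Y a b := by
      ext i j
      simp only [scalarConj, Matrix.of_apply, Matrix.mul_apply, Matrix.conjTranspose_apply,
        star_sum, star_smul, Finset.sum_mul_sum, Finset.smul_sum, smul_mul_smul_comm]
      rw [Finset.sum_comm_cycle]
    rw [this]
    exact cstarCone_rect _
  eq_zero := by
    intro ι _ X h1 h2
    let _ := CStarAlgebra.spectralOrder A
    have _ := CStarAlgebra.spectralOrderedRing A
    rw [mem_cstarCone_iff] at h1 h2
    let x : CStarMatrix ι ι A := CStarMatrix.ofMatrix X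
    have h3 : 0 ≤ -x := h2
    have h4 : x ≤ 0 := by simpa using h3
    exact (le_antisymm h4 h1 : x = 0)
  order_unit := by
    intro ι _ _ X hX
    let _ := CStarAlgebra.spectralOrder A
    have _ := CStarAlgebra.spectralOrderedRing A
    let x : CStarMatrix ι ι A := CStarMatrix.ofMatrix X
    have hx : IsSelfAdjoint x := hX
    refine ⟨‖x‖ + 1, by positivity, ?_⟩
    rw [mem_cstarCone_iff]
    have h1 : 0 ≤ x + algebraMap ℝ _ ‖x‖ := by
      have := hx.neg_algebraMap_norm_le_self
      rwa [neg_le_iff_add_nonneg] at this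
    have h2 : (0 : CStarMatrix ι ι A) ≤ 1 := zero_le_one
    have h3 := add_nonneg h1 h2
    convert h3 using 1
    change x + ((‖x‖ + 1 : ℝ) : ℂ) • (1 : CStarMatrix ι ι A) = _
    rw [Algebra.algebraMap_eq_smul_one, add_assoc]
    congr 1
    push_cast
    rw [add_smul, one_smul]
    rfl
  archimedean := by
    intro ι _ _ X hX h
    let _ := CStarAlgebra.spectralOrder A
    have _ := CStarAlgebra.spectralOrderedRing A
    let x : CStarMatrix ι ι A := CStarMatrix.ofMatrix X
    rw [mem_cstarCone_iff]
    change 0 ≤ x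
    have h' : ∀ r : ℝ, 0 < r → 0 ≤ x + (r : ℂ) • (1 : CStarMatrix ι ι A) := by
      intro r hr
      have := h r hr
      rw [mem_cstarCone_iff] at this
      exact this
    have hc : Filter.Tendsto (fun r : ℝ => x + (r : ℂ) • (1 : CStarMatrix ι ι A))
        (nhdsWithin 0 (Set.Ioi 0)) (nhds x) := by
      have : Continuous (fun r : ℝ => x + (r : ℂ) • (1 : CStarMatrix ι ι A)) := by fun_prop
      have h0 := this.tendsto 0
      simp only [Complex.ofReal_zero, zero_smul, add_zero] at h0
      exact h0.mono_left nhdsWithin_le_nhds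
    exact CStarAlgebra.isClosed_nonneg.mem_of_tendsto hc
      (Filter.eventually_of_mem self_mem_nhdsWithin fun r hr => h' r hr)

end CStar

/-! ### Operator subsystems and matrices over an operator system -/

/-- An operator subsystem: a self-adjoint subspace that contains the order unit. -/
structure OperatorSubsystem (S : Type*) [AddCommGroup S] [Module ℂ S] [StarAddMonoid S]
    [StarModule ℂ S] [OperatorSystem S] extends Submodule ℂ S where
  star_mem' : ∀ {x : S}, x ∈ carrier → star x ∈ carrier
  unit_mem' : (OperatorSystem.unit : S) ∈ carrier

section Constructions

variable {S : Type*} [AddCommGroup S] [Module ℂ S] [StarAddMonoid S] [StarModule ℂ S]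
  [OperatorSystem S]

instance : CoeSort (OperatorSubsystem S) (Type _) := ⟨fun T => T.toSubmodule⟩

instance (T : OperatorSubsystem S) : Star T.toSubmodule where
  star x := ⟨star (x : S), T.star_mem' x.2⟩

instance (T : OperatorSubsystem S) : StarAddMonoid T.toSubmodule where
  star_involutive x := Subtype.ext (star_star (x : S))
  star_add x y := Subtype.ext (star_add (x : S) (y : S))

instance (T : OperatorSubsystem S) : StarModule ℂ T.toSubmodule where
  star_smul c x := Subtype.ext (star_smul c (x : S))

theorem scalarConj_map_val {S : Type*} [AddCommGroup S] [Module ℂ S] (T : Submodule ℂ S) {ι κ : Type} [Fintype ι]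
    (A : Matrix ι κ ℂ) (X : Matrix ι ι T) :
    (scalarConj A X).map Subtype.val = scalarConj A (X.map Subtype.val) := by
  ext i j
  simp [scalarConj]

/-- The matrix cones of an operator subsystem are those of the ambient operator system,
intersected with the matrices over the subsystem. -/
instance (T : OperatorSubsystem S) : OperatorSystem T.toSubmodule where
  unit := ⟨OperatorSystem.unit, T.unit_mem'⟩
  cone ι := {X | X.map Subtype.val ∈ OperatorSystem.cone (S := S) ι}
  star_unit := Subtype.ext OperatorSystem.star_unit
  isHermitian := by
    intro ι _ X hX
    ext i j
    exact congrFun (congrFun (OperatorSystem.isHermitian hX) i) j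
  add_mem := fun hX hY => OperatorSystem.add_mem hX hY
  smul_mem := fun ht hX => OperatorSystem.smul_mem ht hX
  conj_mem := by
    intro ι κ _ _ A X hX
    rw [Set.mem_ofPred_eq, scalarConj_map_val]
    exact OperatorSystem.conj_mem A hX
  eq_zero := by
    intro ι _ X h1 h2
    have := OperatorSystem.eq_zero (X := X.map Subtype.val) h1 h2
    ext i j
    exact congrFun (congrFun this i) j
  order_unit := by
    intro ι _ _ X hX
    obtain ⟨r, hr, h⟩ := OperatorSystem.order_unit (X.map Subtype.val)
      (by ext i j; exact congrArg Subtype.val (congrFun (congrFun hX i) j))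
    refine ⟨r, hr, ?_⟩
    rw [Set.mem_ofPred_eq]
    convert h using 1
    ext i j
    by_cases hij : i = j <;> simp [Matrix.diagonal, hij]
  archimedean := by
    intro ι _ _ X hX h
    refine OperatorSystem.archimedean (X.map Subtype.val)
      (by ext i j; exact congrArg Subtype.val (congrFun (congrFun hX i) j)) ?_
    intro r hr
    have := h r hr
    rw [Set.mem_ofPred_eq] at this
    convert this using 1
    ext i j
    by_cases hij : i = j <;> simp [Matrix.diagonal, hij]

/-- The operator system of `p × p` matrices over `S`: a matrix of matrices is positive when the
flattened matrix over `S` is. In particular the `r × r` complex matrices form an operator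
system, with the usual positive semidefinite matrices. -/
instance {p : Type} [Fintype p] [DecidableEq p] : OperatorSystem (Matrix p p S) where
  unit := Matrix.diagonal fun _ => OperatorSystem.unit
  cone ι := {X | Matrix.comp ι ι p p S X ∈ OperatorSystem.cone (S := S) (ι × p)}
  star_unit := by
    rw [Matrix.star_eq_conjTranspose, Matrix.diagonal_conjTranspose]
    congr 1
    funext _
    exact OperatorSystem.star_unit
  isHermitian := by
    intro ι _ X hX
    ext i j a b
    exact congrFun (congrFun (OperatorSystem.isHermitian hX) (i, a)) (j, b)
  add_mem := fun hX hY => OperatorSystem.add_mem hX hY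
  smul_mem := fun ht hX => OperatorSystem.smul_mem ht hX
  conj_mem := by
    intro ι κ _ _ A X hX
    rw [Set.mem_ofPred_eq]
    convert OperatorSystem.conj_mem
      (Matrix.of fun (x : ι × p) (y : κ × p) => if x.2 = y.2 then A x.1 y.1 else 0) hX using 1
    ext ⟨i, a⟩ ⟨j, b⟩
    simp only [scalarConj, Matrix.comp_apply, Matrix.of_apply, Matrix.sum_apply,
      Matrix.smul_apply, Fintype.sum_prod_type]
    simp [apply_ite star]
  eq_zero := by
    intro ι _ X h1 h2
    have := OperatorSystem.eq_zero (X := Matrix.comp ι ι p p S X) h1 h2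
    ext i j a b
    exact congrFun (congrFun this (i, a)) (j, b)
  order_unit := by
    intro ι _ _ X hX
    obtain ⟨r, hr, h⟩ := OperatorSystem.order_unit (Matrix.comp ι ι p p S X)
      (by
        ext ⟨i, a⟩ ⟨j, b⟩
        exact congrFun (congrFun (congrFun (congrFun hX i) j) a) b)
    refine ⟨r, hr, ?_⟩
    rw [Set.mem_ofPred_eq]
    convert h using 1
    ext ⟨i, a⟩ ⟨j, b⟩
    by_cases hij : i = j <;> by_cases hab : a = b <;> simp [Matrix.diagonal, hij, hab]
  archimedean := by
    intro ι _ _ X hX h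
    refine OperatorSystem.archimedean (Matrix.comp ι ι p p S X)
      (by
        ext ⟨i, a⟩ ⟨j, b⟩
        exact congrFun (congrFun (congrFun (congrFun hX i) j) a) b) ?_
    intro r hr
    have := h r hr
    rw [Set.mem_ofPred_eq] at this
    convert this using 1
    ext ⟨i, a⟩ ⟨j, b⟩
    by_cases hij : i = j <;> by_cases hab : a = b <;> simp [Matrix.diagonal, hij, hab]

end Constructions

/-! ### The minimal and the maximal tensor product -/

section Tensor

variable (S : Type*) [AddCommGroup S] [Module ℂ S] [StarAddMonoid S] [StarModule ℂ S]
  [OperatorSystem S]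
  (T : Type*) [AddCommGroup T] [Module ℂ T] [StarAddMonoid T] [StarModule ℂ T]
  [OperatorSystem T]

variable {S T} in
/-- The map `φ ⊗ ψ : S ⊗ T → M_r ⊗ M_q = M_{rq}` for maps `φ : S → M_r` and `ψ : T → M_q`. -/
def tensorState {r q : ℕ} (φ : S →ₗ[ℂ] Matrix (Fin r) (Fin r) ℂ)
    (ψ : T →ₗ[ℂ] Matrix (Fin q) (Fin q) ℂ) :
    S ⊗[ℂ] T →ₗ[ℂ] Matrix (Fin r × Fin q) (Fin r × Fin q) ℂ :=
  TensorProduct.lift ((Matrix.kroneckerBilinear (R := ℂ) (α := ℂ)).compl₁₂ φ ψ)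

/-- The positive cones of the minimal tensor product. -/
def minCone (ι : Type) [Fintype ι] : Set (Matrix ι ι (S ⊗[ℂ] T)) :=
  {X | Xᴴ = X ∧ ∀ (r q : ℕ) (φ : S →ₗ[ℂ] Matrix (Fin r) (Fin r) ℂ)
    (ψ : T →ₗ[ℂ] Matrix (Fin q) (Fin q) ℂ), IsUCP φ → IsUCP ψ →
      X.map (tensorState φ ψ) ∈ OperatorSystem.cone ι}

variable {S T} in
/-- The elementary tensor `P ⊗ Q` of two matrices. -/
def matrixTensor {k m : ℕ} (P : Matrix (Fin k) (Fin k) S) (Q : Matrix (Fin m) (Fin m) T) :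
    Matrix (Fin k × Fin m) (Fin k × Fin m) (S ⊗[ℂ] T) :=
  Matrix.of fun a b => P a.1 b.1 ⊗ₜ[ℂ] Q a.2 b.2

/-- The matrices `A (P ⊗ Q) A^*` with `P` and `Q` positive and `A` a scalar matrix. -/
def maxPreCone (ι : Type) [Fintype ι] : Set (Matrix ι ι (S ⊗[ℂ] T)) :=
  {X | Xᴴ = X ∧ ∃ (k m : ℕ) (P : Matrix (Fin k) (Fin k) S) (Q : Matrix (Fin m) (Fin m) T)
    (A : Matrix ι (Fin k × Fin m) ℂ), P ∈ OperatorSystem.cone (Fin k) ∧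
      Q ∈ OperatorSystem.cone (Fin m) ∧ X = scalarConj Aᴴ (matrixTensor P Q)}

open Classical in
/-- The positive cones of the maximal tensor product. -/
def maxCone (ι : Type) [Fintype ι] : Set (Matrix ι ι (S ⊗[ℂ] T)) :=
  {X | Xᴴ = X ∧ ∀ ε : ℝ, 0 < ε →
    X + (ε : ℂ) • Matrix.diagonal (fun _ =>
      (OperatorSystem.unit : S) ⊗ₜ[ℂ] (OperatorSystem.unit : T)) ∈ maxPreCone S T ι}

/-- `S ⊗_min T = S ⊗_max T`: the two matrix orderings on `S ⊗ T` coincide. -/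
def MinEqMax : Prop :=
  ∀ (ι : Type) [Fintype ι], minCone S T ι = maxCone S T ι

end Tensor

/-! ### The operator system local lifting property -/

/-- The operator system local lifting property. The quotient maps of unital C*-algebras
by closed two-sided ideals are, up to isomorphism of the target, the surjective unital
`*`-homomorphisms `π : A → B` between unital C*-algebras. -/
def HasOSLLP (S : Type v) [AddCommGroup S] [Module ℂ S] [StarAddMonoid S] [StarModule ℂ S]
    [OperatorSystem S] : Prop :=
  ∀ (A B : Type u) [CStarAlgebra A] [CStarAlgebra B] (π : A →⋆ₐ[ℂ] B), Function.Surjective π →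
    ∀ φ : S →ₗ[ℂ] B, IsUCP φ →
      ∀ T : OperatorSubsystem S, FiniteDimensional ℂ T →
        ∃ ψ : T →ₗ[ℂ] A, IsUCP ψ ∧ ∀ t : T, π (ψ t) = φ t

/-! ### The universal C*-algebra of a unitary matrix -/

/-- A square matrix over a C*-algebra is unitary if `U^* U = 1 = U U^*`. -/
def IsUnitaryMatrix {A : Type*} [CStarAlgebra A] {n : ℕ} (U : Matrix (Fin n) (Fin n) A) : Prop :=
  Uᴴ * U = 1 ∧ U * Uᴴ = 1

/-- A (nonzero) unital C*-algebra together with a unitary `n × n` matrix over it. -/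
structure UnitaryMatrixModel (n : ℕ) : Type (u + 1) where
  A : Type u
  [cstar : CStarAlgebra A]
  [nontriv : Nontrivial A]
  mat : Matrix (Fin n) (Fin n) A
  unitary : IsUnitaryMatrix mat

attribute [instance] UnitaryMatrixModel.cstar UnitaryMatrixModel.nontriv

instance lpCStarAlgebra {I : Type*} {A : I → Type*} [∀ i, Nontrivial (A i)]
    [∀ i, CStarAlgebra (A i)] : CStarAlgebra (lp A ∞) where

theorem norm_entry_le_one {A : Type*} [CStarAlgebra A] {n : ℕ}
    {U : Matrix (Fin n) (Fin n) A} (hU : IsUnitaryMatrix U)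
    (i j : Fin n) : ‖U i j‖ ≤ 1 := by
  let _ := CStarAlgebra.spectralOrder A
  have _ := CStarAlgebra.spectralOrderedRing A
  have h1 : ∑ k, star (U k j) * U k j = 1 := by
    have := congrFun (congrFun hU.1 j) j
    simpa [Matrix.mul_apply] using this
  have h2 : star (U i j) * U i j ≤ 1 := by
    rw [← h1]
    exact Finset.single_le_sum (f := fun k => star (U k j) * U k j)
      (fun k _ => star_mul_self_nonneg _) (Finset.mem_univ i)
  have h3 := (CStarAlgebra.norm_le_one_iff_of_nonneg _ (star_mul_self_nonneg (U i j))).2 h2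
  rw [CStarRing.norm_star_mul_self] at h3
  nlinarith [norm_nonneg (U i j)]

/-- The C*-algebra of bounded families, indexed by all unitary `n × n` matrices over C*-algebras. -/
abbrev BigProduct (n : ℕ) : Type (u + 1) :=
  lp (fun ρ : UnitaryMatrixModel.{u} n => ρ.A) ∞

/-- The family of all `(i,j)`-entries. -/
def bigGen (n : ℕ) (i j : Fin n) : BigProduct.{u} n :=
  ⟨fun ρ => ρ.mat i j, memℓp_infty ⟨1, by
    rintro _ ⟨ρ, rfl⟩
    exact norm_entry_le_one ρ.unitary i j⟩⟩

/-- The universal unital C*-algebra `U_nc(n)` generated by the entries of a unitary `n × n`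
matrix, as the C*-subalgebra generated by the universal matrix entries in the product of all
models; see `Unc.existsUnique_lift` for the universal property. -/
def uncSubalgebra (n : ℕ) : StarSubalgebra ℂ (BigProduct.{u} n) :=
  (StarAlgebra.adjoin ℂ
    (Set.range fun p : Fin n × Fin n => bigGen.{u} n p.1 p.2)).topologicalClosure

/-- The C*-algebra `U_nc(n)` as a type. -/
abbrev Unc (n : ℕ) : Type (u + 1) := uncSubalgebra.{u} n

instance (n : ℕ) : CStarAlgebra (Unc.{u} n) :=
  StarSubalgebra.cstarAlgebra (uncSubalgebra.{u} n)
    (h_closed := StarSubalgebra.isClosed_topologicalClosure _)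

/-- The generators `u_{ij}` of `U_nc(n)`. -/
def Unc.gen (n : ℕ) : Matrix (Fin n) (Fin n) (Unc.{u} n) :=
  Matrix.of fun i j => ⟨bigGen n i j, StarSubalgebra.le_topologicalClosure _
    (StarAlgebra.subset_adjoin ℂ _ ⟨(i, j), rfl⟩)⟩

/-- Evaluation of a bounded family at a model. -/
def evalModel {n : ℕ} (ρ : UnitaryMatrixModel.{u} n) : BigProduct.{u} n →⋆ₐ[ℂ] ρ.A where
  toFun f := f ρ
  map_one' := rfl
  map_mul' _ _ := rfl
  map_zero' := rfl
  map_add' _ _ := rfl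
  commutes' _ := rfl
  map_star' _ := rfl

theorem starAlgHom_continuous {A B : Type*} [CStarAlgebra A] [CStarAlgebra B] (π : A →⋆ₐ[ℂ] B) :
    Continuous π :=
  AddMonoidHomClass.continuous_of_bound π 1 fun x => by
    simpa using NonUnitalStarAlgHom.norm_apply_le π x

theorem Unc.ext_model {n : ℕ} {x y : Unc.{u} n}
    (h : ∀ ρ, evalModel ρ (x : BigProduct.{u} n) = evalModel ρ (y : BigProduct.{u} n)) : x = y :=
  Subtype.ext (Subtype.ext (funext h))

theorem Unc.gen_unitary (n : ℕ) : IsUnitaryMatrix (Unc.gen.{u} n) := by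
  constructor
  all_goals
    refine Matrix.ext fun i j => Unc.ext_model fun ρ => ?_
    let ev : Unc.{u} n →⋆ₐ[ℂ] ρ.A := (evalModel ρ).comp (uncSubalgebra n).subtype
    change ev _ = ev _
    have hg : ∀ i j, ev (Unc.gen n i j) = ρ.mat i j := fun _ _ => rfl
    have h1 := congrFun (congrFun ρ.unitary.1 i) j
    have h2 := congrFun (congrFun ρ.unitary.2 i) j
    simp only [Matrix.mul_apply, Matrix.conjTranspose_apply, Matrix.one_apply] at h1 h2 ⊢
    simp only [map_sum, map_mul, map_star, hg, h1, h2]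
    split_ifs <;> simp

/-- The universal property of `U_nc(n)`. -/
theorem Unc.existsUnique_lift {n : ℕ} {B : Type u} [CStarAlgebra B]
    (W : Matrix (Fin n) (Fin n) B) (hW : IsUnitaryMatrix W) :
    ∃! π : Unc.{u} n →⋆ₐ[ℂ] B, ∀ i j, π (Unc.gen n i j) = W i j := by
  refine existsUnique_of_exists_of_unique ?_ ?_
  · rcases subsingleton_or_nontrivial B with hB | hB
    · exact ⟨{ toFun := fun _ => 0
               map_one' := Subsingleton.elim _ _
               map_mul' := fun _ _ => Subsingleton.elim _ _
               map_zero' := rfl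
               map_add' := fun _ _ => Subsingleton.elim _ _
               commutes' := fun _ => Subsingleton.elim _ _
               map_star' := fun _ => Subsingleton.elim _ _ }, fun _ _ => Subsingleton.elim _ _⟩
    · exact ⟨(evalModel ⟨B, W, hW⟩).comp (uncSubalgebra n).subtype, fun _ _ => rfl⟩
  · intro π₁ π₂ h₁ h₂
    refine StarAlgHom.ext_topologicalClosure (starAlgHom_continuous (A := Unc.{u} n) π₁)
      (starAlgHom_continuous (A := Unc.{u} n) π₂) ?_
    refine StarAlgHom.ext_adjoin ?_
    rintro ⟨x, hx⟩ ⟨⟨i, j⟩, rfl⟩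
    exact (h₁ i j).trans (h₂ i j).symm

/-! ### The operator system `V_n` and property `V` -/

/-- The operator system `V_n`: the span of `1`, the `u_{ij}` and the `u_{ij}^*` in `U_nc(n)`. -/
def Vsys (n : ℕ) : OperatorSubsystem (Unc.{u} n) where
  toSubmodule := Submodule.span ℂ ({1} ∪ (Set.range fun p : Fin n × Fin n => Unc.gen n p.1 p.2) ∪
    Set.range fun p : Fin n × Fin n => star (Unc.gen n p.1 p.2))
  star_mem' := by
    intro x hx
    change x ∈ Submodule.span ℂ _ at hx
    change star x ∈ Submodule.span ℂ _
    induction hx using Submodule.span_induction with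
    | mem x h =>
      apply Submodule.subset_span
      rcases h with (rfl | ⟨p, rfl⟩) | ⟨p, rfl⟩
      · simp
      · exact Or.inr ⟨p, rfl⟩
      · exact Or.inl (Or.inr ⟨p, by simp⟩)
    | zero => simp
    | add x y _ _ h1 h2 => rw [star_add]; exact Submodule.add_mem _ h1 h2
    | smul c x _ h => rw [star_smul]; exact Submodule.smul_mem _ _ h
  unit_mem' := Submodule.subset_span (Or.inl (Or.inl rfl))

section PropertyV

variable (S : Type v) [AddCommGroup S] [Module ℂ S] [StarAddMonoid S] [StarModule ℂ S]
  [OperatorSystem S]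

/-- Property `V_n` of an operator system `S`. The `2n` row and column indices are `Fin n ⊕ Fin n`:
`B i j` is the coefficient with index `(i, n + j)`, belonging to `u_{ij}`, and `C i j` the one
with index `(n + i, j)`, belonging to `u_{ji}^*`. -/
def HasPropertyVn (n : ℕ) : Prop :=
  ∀ (p : ℕ) (S₀ : Matrix (Fin p) (Fin p) S)
    (B C : Fin n → Fin n → Matrix (Fin p) (Fin p) S),
    (Matrix.of fun _ _ : Fin 1 =>
      (1 : Unc.{u} n) ⊗ₜ[ℂ] S₀
        + ∑ i, ∑ j, ((1 / (2 * n) : ℂ) • Unc.gen n i j) ⊗ₜ[ℂ] B i j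
        + ∑ i, ∑ j, ((1 / (2 * n) : ℂ) • star (Unc.gen n j i)) ⊗ₜ[ℂ] C i j)
      ∈ minCone (Unc.{u} n) (Matrix (Fin p) (Fin p) S) (Fin 1) →
    ∀ ε : ℝ, 0 < ε →
      ∃ R : Matrix (Fin n ⊕ Fin n) (Fin n ⊕ Fin n) (Matrix (Fin p) (Fin p) S),
        R ∈ OperatorSystem.cone (Fin n ⊕ Fin n) ∧
        (∀ i j, R (Sum.inl i) (Sum.inr j) = B i j) ∧
        (∀ i j, R (Sum.inr i) (Sum.inl j) = C i j) ∧
        ∑ k, R k k = (2 * n : ℂ) • (S₀ + (ε : ℂ) • OperatorSystem.unit)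

/-- Property `V`: property `V_n` for every `n ≥ 1`. -/
def HasPropertyV : Prop :=
  ∀ n : ℕ, 1 ≤ n → HasPropertyVn.{u} S n

end PropertyV

end

/-!
Two facts carry the proof.

A contraction dilates to a unitary: if `T` is a self-adjoint contraction in `M_{2n}(A)`, then `T` is
the mean of the unitary `T + i √(1 - T²)` and its adjoint. Reading a unitary of `M_{2n}(A)` as a
unitary `n × n` matrix over `M_2(A)` and taking a corner of the resulting representation of
`U_nc(n)`, one finds that every matrix `c` over `A` with `[1, c; c^*, 1] ≥ 0` is the image of the
universal unitary under a unital completely positive (ucp) map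
(`exists_ucp_of_fromBlocks_mem_cone`). Hence ucp maps on `V_n` are the same as contractions. The
lifting property follows: the contraction `φ(u)` over a quotient lifts, by truncating a
self-adjoint lift of `[0, φ(u); φ(u)^*, 0]` to `[-1, 1]` in the functional calculus
(`hasOSLLP_Vsys`).

The second fact is an extension theorem. Let `1 ⊗ S₀ + (1/2n) ∑ u_{ij} ⊗ B i j +
(1/2n) ∑ u_{ji}^* ⊗ C i j` be positive over the operators on a Hilbert space `K`. A positive
operator matrix `R` with off-diagonal blocks `B`, `C` and `∑ R k k = 2n S₀` is sought. As a
functional `X ↦ tr (X R)` on the finite rank operators `X` on `K^{2n}`, it is prescribed on those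
`X` whose diagonal blocks are both of the form `1 ⊗ d`. There it is nonnegative at every positive
`X = [1 ⊗ d, x; x^*, 1 ⊗ d]`: after adding a small multiple of the identity, `d = hᴴ h` with `h`
invertible, so `x i j = hᴴ φ(u_{ij}) h` for a matrix-valued ucp map `φ` by the first fact, and the
value at `X` is a value of the given positive element under `φ`
(`IsPositivePencil.pencilForm_nonneg`). Every positive finite rank operator is dominated by one with
constant diagonal, so the M. Riesz extension theorem gives a positive functional on all finite rank
operators, which is bounded on the rank one projections and hence comes from an operator by
polarization (`IsPositivePencil.exists_matrix`).

Applied to `K = H^p` this is property `V` of `B(H)`. It also gives the equality of the tensor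
products: an element of the minimal cone of `V_n ⊗ B(H)` is a pencil as above, and equals
`(1/2n) ∑ P k l ⊗ R k l` with `P = [1, u; u^*, 1]`, which is visibly in the maximal cone
(`minCone_subset_maxPreCone`).
-/

universe w

noncomputable section

/-! ### Unital completely positive maps are self-adjoint -/

section StarPreserving

variable {S : Type*} [AddCommGroup S] [Module ℂ S] [StarAddMonoid S] [StarModule ℂ S]
  [OperatorSystem S]
  {T : Type*} [AddCommGroup T] [Module ℂ T] [StarAddMonoid T] [StarModule ℂ T]
  [OperatorSystem T]

/-- A positive map preserves self-adjointness, because every self-adjoint element is a difference of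
a positive element and a multiple of the unit. -/
theorem IsUCP.star_map_of_star_eq {φ : S →ₗ[ℂ] T} (hφ : IsUCP φ) {x : S} (hx : star x = x) :
    star (φ x) = φ x := by
  obtain ⟨r, -, hr⟩ := OperatorSystem.order_unit (Matrix.of fun _ _ : Unit => x)
    (by ext; simpa using hx)
  have h := congrFun (congrFun (OperatorSystem.isHermitian (hφ.2 Unit _ hr)) ()) ()
  simpa [hφ.1, OperatorSystem.star_unit] using h

theorem IsUCP.map_star {φ : S →ₗ[ℂ] T} (hφ : IsUCP φ) (x : S) : φ (star x) = star (φ x) := by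
  have h1 := hφ.star_map_of_star_eq (x := x + star x) (by simp [add_comm])
  -- real and imaginary part of `x`
  have h2 := hφ.star_map_of_star_eq (x := Complex.I • (x - star x)) (by
    simp [star_smul, ← smul_neg])
  simp only [map_add, star_add, map_smul, map_sub, star_smul, star_sub, RCLike.star_def,
    Complex.conj_I, neg_smul, ← smul_neg] at h1 h2
  have h3 := smul_right_injective T Complex.I_ne_zero h2
  have h4 : (2 : ℂ) • φ (star x) = (2 : ℂ) • star (φ x) := by
    rw [two_smul, two_smul]
    have h5 : φ (star x) + φ (star x) =
        (φ x + φ (star x)) - (φ x - φ (star x)) := by abel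
    rw [h5, ← h1, ← h3]
    abel
  exact smul_right_injective T two_ne_zero h4

end StarPreserving

/-! ### Dilation of contractions to unitaries -/

section Dilation

variable {A : Type w} [CStarAlgebra A] [PartialOrder A] [StarOrderedRing A] {n : ℕ}

/-- The index of a row of a `2n × 2n` matrix with a given block and a given position in it. -/
def blockIdx (b : Bool) (i : Fin n) : Fin n ⊕ Fin n :=
  if b then Sum.inl i else Sum.inr i

theorem blockIdx_inj {b c : Bool} {i j : Fin n} :
    blockIdx b i = blockIdx c j ↔ i = j ∧ b = c := by
  cases b <;> cases c <;> simp [blockIdx]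

/-- The type `ULift Bool` instead of `Bool` puts the `2 × 2` matrices over `A` into a universe in
which the universal property of `U_nc(n)` applies. -/
theorem sum_blockIdx {M : Type*} [AddCommMonoid M] (f : Fin n ⊕ Fin n → M) :
    ∑ i, ∑ b : ULift.{u} Bool, f (blockIdx b.down i) = ∑ k, f k := by
  rw [Finset.sum_comm, ← Equiv.ulift.symm.sum_comp]
  simp [blockIdx]

theorem sum_blockIdx_not {M : Type*} [AddCommMonoid M] (f : Fin n ⊕ Fin n → M) :
    ∑ i, ∑ b : ULift.{u} Bool, f (blockIdx (!b.down) i) = ∑ k, f k := by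
  rw [Finset.sum_comm, ← Equiv.ulift.symm.sum_comp]
  simp [blockIdx, add_comm]

/-- A `2n × 2n` matrix over `A`, with its two blocks of columns exchanged, read as an `n × n`
matrix over the `2 × 2` matrices. -/
def swapBlocks (W : CStarMatrix (Fin n ⊕ Fin n) (Fin n ⊕ Fin n) A) :
    Matrix (Fin n) (Fin n) (CStarMatrix (ULift.{u} Bool) (ULift.{u} Bool) A) :=
  Matrix.of fun i j => CStarMatrix.ofMatrix <| Matrix.of fun b c =>
    W (blockIdx b.down i) (blockIdx (!c.down) j)

theorem CStarMatrix.finset_sum_apply {ι α m k : Type*} [AddCommMonoid α]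
    (s : Finset ι) (f : ι → CStarMatrix m k α) (a : m) (b : k) :
    (∑ i ∈ s, f i) a b = ∑ i ∈ s, f i a b :=
  Matrix.sum_apply a b s f

theorem isUnitaryMatrix_swapBlocks {W : CStarMatrix (Fin n ⊕ Fin n) (Fin n ⊕ Fin n) A}
    (hW : W ∈ unitary (CStarMatrix (Fin n ⊕ Fin n) (Fin n ⊕ Fin n) A)) :
    IsUnitaryMatrix (swapBlocks.{u} W) := by
  constructor
  · ext i j b c
    have h := CStarMatrix.ext_iff.2 (Unitary.star_mul_self_of_mem hW)
      (blockIdx (!b.down) i) (blockIdx (!c.down) j)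
    rw [CStarMatrix.mul_apply, ← sum_blockIdx.{u}] at h
    rw [Matrix.mul_apply, CStarMatrix.finset_sum_apply]
    simp only [CStarMatrix.mul_apply]
    refine Eq.trans h ?_
    simp only [CStarMatrix.one_apply, Matrix.one_apply, blockIdx_inj]
    by_cases hij : i = j <;> simp [hij, CStarMatrix.one_apply]
  · ext i j b c
    have h := CStarMatrix.ext_iff.2 (Unitary.mul_star_self_of_mem hW)
      (blockIdx b.down i) (blockIdx c.down j)
    rw [CStarMatrix.mul_apply, ← sum_blockIdx_not.{u}] at h
    rw [Matrix.mul_apply, CStarMatrix.finset_sum_apply]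
    simp only [CStarMatrix.mul_apply]
    refine Eq.trans h ?_
    simp only [CStarMatrix.one_apply, Matrix.one_apply, blockIdx_inj]
    by_cases hij : i = j <;> simp [hij, CStarMatrix.one_apply]

/-- A diagonal entry of a `*`-homomorphism into matrices is unital completely positive. -/
theorem isUCP_diagonalEntry {B : Type*} [CStarAlgebra B] {A : Type*} [CStarAlgebra A]
    [PartialOrder A] [StarOrderedRing A]
    (π : B →⋆ₐ[ℂ] CStarMatrix (ULift.{u} Bool) (ULift.{u} Bool) A)
    (b : ULift.{u} Bool) (ψ : B →ₗ[ℂ] A) (hψ : ∀ x, ψ x = π x b b) : IsUCP ψ := by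
  refine ⟨?_, ?_⟩
  · change ψ 1 = 1
    simp [hψ]
  · rintro ι _ X ⟨Y, rfl⟩
    change (Yᴴ * Y).map ψ ∈ cstarCone A ι
    convert cstarCone_rect
      (Matrix.of fun (p : ι × Bool) (j : ι) => π (Y p.1 j) ⟨p.2⟩ b) using 1
    ext i j
    rw [Matrix.map_apply, hψ]
    simp only [Matrix.mul_apply, Matrix.conjTranspose_apply, map_sum, map_mul,
      CStarMatrix.finset_sum_apply, CStarMatrix.mul_apply, Fintype.sum_prod_type, map_star,
      Matrix.of_apply, CStarMatrix.star_apply]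
    refine Finset.sum_congr rfl fun k _ => ?_
    rw [← Equiv.ulift.symm.sum_comp]
    rfl

/-- The upper right block of a unitary `2n × 2n` matrix is the image of the universal unitary: it
is the corner of the unitary `n × n` matrix `swapBlocks W`, hence of a representation. -/
theorem exists_ucp_of_unitary {W : CStarMatrix (Fin n ⊕ Fin n) (Fin n ⊕ Fin n) A}
    (hW : W ∈ unitary (CStarMatrix (Fin n ⊕ Fin n) (Fin n ⊕ Fin n) A)) :
    ∃ ψ : Unc.{max u w} n →ₗ[ℂ] A, IsUCP ψ ∧
      ∀ i j, ψ (Unc.gen n i j) = W (Sum.inl i) (Sum.inr j) := by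
  obtain ⟨π, hπ, -⟩ := Unc.existsUnique_lift.{max u w} _ (isUnitaryMatrix_swapBlocks.{u} hW)
  let ψ : Unc.{max u w} n →ₗ[ℂ] A :=
    { toFun := fun x => π x ⟨true⟩ ⟨true⟩
      map_add' := fun x y => by rw [map_add]; rfl
      map_smul' := fun c x => by rw [map_smul]; rfl }
  refine ⟨ψ, isUCP_diagonalEntry π ⟨true⟩ ψ fun _ => rfl, fun i j => ?_⟩
  change π _ _ _ = _
  rw [hπ]
  rfl

/-- Every self-adjoint contraction `T` over `A` gives a unital completely positive map that sends
the universal unitary to the upper right block of `T`: the contraction is the mean of the unitary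
`T + i √(1 - T²)` and its adjoint. -/
theorem exists_ucp_of_selfAdjoint_contraction
    {T : CStarMatrix (Fin n ⊕ Fin n) (Fin n ⊕ Fin n) A} (hT : IsSelfAdjoint T) (hT1 : ‖T‖ ≤ 1) :
    ∃ ψ : Unc.{max u w} n →ₗ[ℂ] A, IsUCP ψ ∧
      ∀ i j, ψ (Unc.gen n i j) = T (Sum.inl i) (Sum.inr j) := by
  let a : selfAdjoint (CStarMatrix (Fin n ⊕ Fin n) (Fin n ⊕ Fin n) A) := ⟨T, hT⟩
  let W := selfAdjoint.unitarySelfAddISMul a hT1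
  obtain ⟨ψ₁, h₁, e₁⟩ := exists_ucp_of_unitary.{u} W.2
  obtain ⟨ψ₂, h₂, e₂⟩ := exists_ucp_of_unitary.{u} (star W).2
  refine ⟨((1 / 2 : ℝ) : ℂ) • (ψ₁ + ψ₂), ⟨?_, ?_⟩, fun i j => ?_⟩
  · rw [LinearMap.smul_apply, LinearMap.add_apply, h₁.1, h₂.1, ← two_smul ℂ, smul_smul]
    norm_num
  · intro ι _ X hX
    exact OperatorSystem.smul_mem (by norm_num)
      (OperatorSystem.add_mem (h₁.2 ι X hX) (h₂.2 ι X hX))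
  · have h : (W : CStarMatrix (Fin n ⊕ Fin n) (Fin n ⊕ Fin n) A) + (star W : unitary _) =
        (2 : ℂ) • T := by
      have h' := selfAdjoint.star_coe_unitarySelfAddISMul a hT1
      have h'' := selfAdjoint.unitarySelfAddISMul_coe a hT1
      rw [← Unitary.coe_star] at h'
      rw [h', h'', add_add_sub_cancel, two_smul]
    rw [LinearMap.smul_apply, LinearMap.add_apply, e₁, e₂, ← CStarMatrix.add_apply, h,
      CStarMatrix.smul_apply, smul_smul]
    norm_num

end Dilation

/-! ### Positive block matrices and contractions -/

section Contraction

/-- Reversing the sign of the off-diagonal blocks preserves positivity. -/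
theorem fromBlocks_neg_mem_cone {S : Type*} [AddCommGroup S] [Module ℂ S] [StarAddMonoid S]
    [StarModule ℂ S] [OperatorSystem S] {k l : Type} [Fintype k] [Fintype l]
    {a : Matrix k k S} {b : Matrix k l S} {c : Matrix l k S} {d : Matrix l l S}
    (h : Matrix.fromBlocks a b c d ∈ OperatorSystem.cone (S := S) (k ⊕ l)) :
    Matrix.fromBlocks a (-b) (-c) d ∈ OperatorSystem.cone (S := S) (k ⊕ l) := by
  classical
  convert OperatorSystem.conj_mem
    (Matrix.diagonal (Sum.elim (fun _ : k => (1 : ℂ)) fun _ : l => -1)) h using 1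
  ext (i | i) (j | j) <;>
    simp [scalarConj, Matrix.diagonal_apply, ite_smul, apply_ite star]

variable {A : Type w} [CStarAlgebra A] {n : ℕ}

theorem norm_le_one_of_neg_one_le [PartialOrder A] [StarOrderedRing A] {a : A}
    (ha : IsSelfAdjoint a) (h1 : 0 ≤ 1 + a) (h2 : 0 ≤ 1 - a) : ‖a‖ ≤ 1 := by
  rcases subsingleton_or_nontrivial A with _ | _
  · simp [Subsingleton.elim a 0]
  have h3 : a ≤ algebraMap ℝ A 1 := by simpa using h2
  have h4 : algebraMap ℝ A (-1) ≤ a := by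
    simpa [neg_le_iff_add_nonneg', add_comm] using h1
  rw [le_algebraMap_iff_spectrum_le] at h3
  rw [algebraMap_le_iff_le_spectrum] at h4
  rcases CStarAlgebra.norm_or_neg_norm_mem_spectrum ha with h | h
  · exact h3 _ h
  · linarith [h4 _ h]

/-- The self-adjoint matrix with off-diagonal blocks `c` and `cᴴ`. -/
def offDiagonal (c : Matrix (Fin n) (Fin n) A) : CStarMatrix (Fin n ⊕ Fin n) (Fin n ⊕ Fin n) A :=
  CStarMatrix.ofMatrix (Matrix.fromBlocks 0 c cᴴ 0)

theorem isSelfAdjoint_offDiagonal (c : Matrix (Fin n) (Fin n) A) :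
    IsSelfAdjoint (offDiagonal c) := by
  change (Matrix.fromBlocks 0 c cᴴ 0)ᴴ = Matrix.fromBlocks 0 c cᴴ 0
  simp [Matrix.fromBlocks_conjTranspose]

/-- The matrix `[1, c; c^*, 1]` is positive only if `c` is a contraction. -/
theorem norm_offDiagonal_le_one [PartialOrder A] [StarOrderedRing A]
    {c : Matrix (Fin n) (Fin n) A}
    (h : Matrix.fromBlocks 1 c cᴴ 1 ∈ OperatorSystem.cone (S := A) (Fin n ⊕ Fin n)) :
    ‖offDiagonal c‖ ≤ 1 := by
  refine norm_le_one_of_neg_one_le (isSelfAdjoint_offDiagonal c) ?_ ?_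
  · convert mem_cstarCone_iff.1 h using 1
    have h1 : 1 + Matrix.fromBlocks 0 c cᴴ 0 = Matrix.fromBlocks 1 c cᴴ 1 := by
      rw [← Matrix.fromBlocks_one, Matrix.fromBlocks_add]
      simp
    exact congrArg CStarMatrix.ofMatrix h1
  · convert mem_cstarCone_iff.1 (fromBlocks_neg_mem_cone h) using 1
    have h1 : 1 - Matrix.fromBlocks 0 c cᴴ 0 = Matrix.fromBlocks 1 (-c) (-cᴴ) 1 := by
      rw [← Matrix.fromBlocks_one, sub_eq_add_neg, Matrix.fromBlocks_neg, Matrix.fromBlocks_add]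
      simp
    exact congrArg CStarMatrix.ofMatrix h1

/-- Every contraction `c` over `A` is the image of the universal unitary under a unital completely
positive map. -/
theorem exists_ucp_of_fromBlocks_mem_cone {c : Matrix (Fin n) (Fin n) A}
    (h : Matrix.fromBlocks 1 c cᴴ 1 ∈ OperatorSystem.cone (S := A) (Fin n ⊕ Fin n)) :
    ∃ ψ : Unc.{max u w} n →ₗ[ℂ] A, IsUCP ψ ∧ ∀ i j, ψ (Unc.gen n i j) = c i j := by
  let _ := CStarAlgebra.spectralOrder A
  have _ := CStarAlgebra.spectralOrderedRing A
  exact exists_ucp_of_selfAdjoint_contraction.{u} (isSelfAdjoint_offDiagonal c)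
    (norm_offDiagonal_le_one h)

theorem fromBlocks_one_mem_cone_of_unitary {U : Matrix (Fin n) (Fin n) A}
    (hU : IsUnitaryMatrix U) :
    Matrix.fromBlocks 1 U Uᴴ 1 ∈ OperatorSystem.cone (S := A) (Fin n ⊕ Fin n) := by
  -- the matrix is `Z^* Z` for the row `Z = (1, U)`, completed by zeros to a square matrix
  refine ⟨Matrix.fromBlocks 1 U 0 0, ?_⟩
  rw [Matrix.fromBlocks_conjTranspose, Matrix.fromBlocks_multiply]
  simp [hU.1]

end Contraction

/-! ### The lifting property of `V_n` -/

section Lifting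

/-- Self-adjoint contractions lift along quotient maps: truncate any self-adjoint lift to
`[-1, 1]` by the functional calculus. -/
theorem exists_selfAdjoint_contraction_lift {A B : Type*} [CStarAlgebra A] [CStarAlgebra B]
    (π : A →⋆ₙₐ[ℂ] B) (hπ : Function.Surjective π) {b : B} (hb : IsSelfAdjoint b)
    (hb1 : ‖b‖ ≤ 1) : ∃ a : A, IsSelfAdjoint a ∧ ‖a‖ ≤ 1 ∧ π a = b := by
  obtain ⟨x, rfl⟩ := hπ b
  let y : A := (1 / 2 : ℝ) • (x + star x)
  have hy : IsSelfAdjoint y := by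
    simp [y, IsSelfAdjoint, add_comm]
  have hxy : π y = π x := by
    have h : π y = (1 / 2 : ℂ) • (π x + star (π x)) := by
      rw [← map_star, ← map_add, ← map_smul]
      refine congrArg π ?_
      change (1 / 2 : ℝ) • (x + star x) = _
      rw [← Complex.coe_smul]
      norm_num
    rw [h, hb.star_eq, ← two_smul ℂ, smul_smul]
    norm_num
  let f : ℝ → ℝ := fun t => max (-1) (min t 1)
  have hf : Continuous f := by fun_prop
  have hf0 : f 0 = 0 := by simp [f]
  refine ⟨cfcₙ f y, cfcₙ_predicate f y, ?_, ?_⟩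
  · refine norm_cfcₙ_le fun t _ => ?_
    rw [Real.norm_eq_abs, abs_le]
    exact ⟨le_max_left _ _, max_le (by norm_num) (min_le_right _ _)⟩
  · have hcont : Continuous π :=
      AddMonoidHomClass.continuous_of_bound π 1 fun x => by
        simpa using NonUnitalStarAlgHom.norm_apply_le π x
    rw [NonUnitalStarAlgHomClass.map_cfcₙ (R := ℝ) (S := ℂ) π f y hf.continuousOn hf0 hcont hy
      (hxy ▸ hb), hxy]
    conv_rhs => rw [← cfcₙ_id ℝ (π x) hb]
    refine cfcₙ_congr fun t ht => ?_
    have h1 : |t| ≤ 1 := by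
      rw [quasispectrum_eq_spectrum_union_zero] at ht
      rcases ht with ht | ht
      · rcases subsingleton_or_nontrivial B with _ | _
        · simp at ht
        · exact (spectrum.norm_le_norm_of_mem ht).trans hb1
      · simp [Set.mem_singleton_iff.1 ht]
    rw [abs_le] at h1
    simp [f, h1.1, h1.2]

/-- The entries of the universal unitary as elements of `V_n`. -/
def Vsys.gen (n : ℕ) : Matrix (Fin n) (Fin n) (Vsys.{u} n) :=
  Matrix.of fun i j => ⟨Unc.gen n i j, Submodule.subset_span (Or.inl (Or.inr ⟨(i, j), rfl⟩))⟩

theorem Vsys.fromBlocks_gen_mem_cone (n : ℕ) :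
    Matrix.fromBlocks (Matrix.diagonal fun _ => OperatorSystem.unit) (Vsys.gen.{u} n)
      (Vsys.gen.{u} n)ᴴ (Matrix.diagonal fun _ => OperatorSystem.unit) ∈
      OperatorSystem.cone (S := Vsys.{u} n) (Fin n ⊕ Fin n) := by
  change Matrix.map _ Subtype.val ∈ OperatorSystem.cone (S := Unc.{u} n) (Fin n ⊕ Fin n)
  refine Set.mem_of_eq_of_mem ?_ (fromBlocks_one_mem_cone_of_unitary (Unc.gen_unitary.{u} n))
  ext (i | i) (j | j)
  · by_cases h : i = j <;> simp [h]; rfl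
  · rfl
  · rfl
  · by_cases h : i = j <;> simp [h]; rfl

theorem Vsys.span_eq_top (n : ℕ) :
    Submodule.span ℂ ({OperatorSystem.unit} ∪
      (Set.range fun p : Fin n × Fin n => Vsys.gen.{u} n p.1 p.2) ∪
      Set.range fun p : Fin n × Fin n => star (Vsys.gen.{u} n p.1 p.2)) = ⊤ := by
  apply Submodule.map_injective_of_injective (Vsys.{u} n).toSubmodule.injective_subtype
  rw [Submodule.map_span, Submodule.map_subtype_top, Set.image_union, Set.image_union,
    Set.image_singleton, ← Set.range_comp, ← Set.range_comp]
  rfl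

/-- Two linear maps on `V_n` agree if they agree on the unit, the generators and their adjoints. -/
theorem Vsys.linearMap_ext {n : ℕ} {M : Type*} [AddCommGroup M] [Module ℂ M]
    {f g : Vsys.{u} n →ₗ[ℂ] M} (h1 : f OperatorSystem.unit = g OperatorSystem.unit)
    (h2 : ∀ i j, f (Vsys.gen n i j) = g (Vsys.gen n i j))
    (h3 : ∀ i j, f (star (Vsys.gen n i j)) = g (star (Vsys.gen n i j))) : f = g := by
  refine LinearMap.ext_on (Vsys.span_eq_top n) ?_
  rintro _ ((rfl | ⟨p, rfl⟩) | ⟨p, rfl⟩)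
  exacts [h1, h2 _ _, h3 _ _]

/-- The whole system `V_n` lifts: the contraction `φ(u)` lifts to a contraction, and this
contraction is the image of `u` under a unital completely positive map on `U_nc(n)`. -/
theorem hasOSLLP_Vsys (n : ℕ) : HasOSLLP.{u} (Vsys.{u} n) := by
  intro A B _ _ π hπ φ hφ T _
  let _ := CStarAlgebra.spectralOrder A
  have _ := CStarAlgebra.spectralOrderedRing A
  let _ := CStarAlgebra.spectralOrder B
  have _ := CStarAlgebra.spectralOrderedRing B
  let b : Matrix (Fin n) (Fin n) B := (Vsys.gen n).map φ
  have hb : Matrix.fromBlocks 1 b bᴴ 1 ∈ OperatorSystem.cone (S := B) (Fin n ⊕ Fin n) := by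
    convert hφ.2 _ _ (Vsys.fromBlocks_gen_mem_cone.{u} n) using 1
    rw [Matrix.fromBlocks_map, Matrix.diagonal_map (map_zero φ), hφ.1]
    congr 1
    ext i j
    simp [b, hφ.map_star]
  let N := Fin n ⊕ Fin n
  let Θ : CStarMatrix N N A →⋆ₙₐ[ℂ] CStarMatrix N N B :=
    CStarMatrix.mapₙₐ (π : A →⋆ₙₐ[ℂ] B)
  have hΘ : Function.Surjective Θ := by
    intro M
    choose f hf using fun i j => hπ (M i j)
    exact ⟨CStarMatrix.ofMatrix (Matrix.of f), CStarMatrix.ext fun i j => hf i j⟩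
  obtain ⟨a, ha, ha1, hab⟩ := exists_selfAdjoint_contraction_lift Θ hΘ
    (isSelfAdjoint_offDiagonal b) (norm_offDiagonal_le_one hb)
  obtain ⟨ψ, hψ, hψa⟩ := exists_ucp_of_selfAdjoint_contraction.{u} ha ha1
  have hgen : ∀ i j, π (ψ (Unc.gen n i j)) = φ (Vsys.gen n i j) := by
    intro i j
    rw [hψa]
    exact CStarMatrix.ext_iff.2 hab (Sum.inl i) (Sum.inr j)
  have key : (π : A →ₐ[ℂ] B).toLinearMap ∘ₗ ψ ∘ₗ (Vsys.{u} n).toSubmodule.subtype = φ := by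
    refine Vsys.linearMap_ext ?_ hgen ?_
    · rw [hφ.1]
      exact (congrArg π hψ.1).trans (map_one π)
    · intro i j
      rw [hφ.map_star, ← hgen, ← map_star, ← hψ.map_star]
      rfl
  refine ⟨ψ ∘ₗ (Vsys.{u} n).toSubmodule.subtype ∘ₗ T.toSubmodule.subtype,
    ⟨hψ.1, fun ι _ X hX => hψ.2 ι _ hX⟩, fun t => LinearMap.congr_fun key t⟩

end Lifting

/-! ### Positive matrices over matrix algebras -/

section MatrixCones

open scoped ComplexOrder

variable {ι m : Type} [Fintype ι] [Fintype m] [DecidableEq m]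

open scoped MatrixOrder in
theorem exists_conjTranspose_mul_self {X : Matrix m m ℂ} (hX : X.PosSemidef) :
    ∃ Y : Matrix m m ℂ, X = Yᴴ * Y := by
  refine ⟨CFC.sqrt X, ?_⟩
  have h : (CFC.sqrt X)ᴴ = CFC.sqrt X := (CFC.sqrt_nonneg X).isSelfAdjoint
  rw [h, CFC.sqrt_mul_sqrt_self X hX.nonneg]

theorem mem_cone_complex_iff {X : Matrix ι ι ℂ} :
    X ∈ OperatorSystem.cone (S := ℂ) ι ↔ X.PosSemidef := by
  classical
  exact ⟨fun ⟨Y, hY⟩ => hY ▸ Matrix.posSemidef_conjTranspose_mul_self Y,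
    exists_conjTranspose_mul_self⟩

/-- In the operator system of matrices over `M_m`, positivity of the flattened matrix is positivity
in the C*-algebra of matrices over `M_m`. -/
theorem mem_cone_matrix_iff {X : Matrix ι ι (Matrix m m ℂ)} :
    X ∈ OperatorSystem.cone (S := Matrix m m ℂ) ι ↔
      ∃ Y : Matrix ι ι (Matrix m m ℂ), X = Yᴴ * Y := by
  have key : ∀ Y : Matrix ι ι (Matrix m m ℂ), Matrix.comp ι ι m m ℂ (Yᴴ * Y) =
      (Matrix.comp ι ι m m ℂ Y)ᴴ * Matrix.comp ι ι m m ℂ Y := by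
    intro Y
    ext ⟨i, a⟩ ⟨j, b⟩
    simp [Matrix.mul_apply, Matrix.sum_apply, Fintype.sum_prod_type]
  constructor
  · rintro ⟨Y, hY⟩
    refine ⟨(Matrix.comp ι ι m m ℂ).symm Y, (Matrix.comp ι ι m m ℂ).injective ?_⟩
    rw [key, Equiv.apply_symm_apply]
    exact hY
  · rintro ⟨Y, rfl⟩
    exact ⟨_, key Y⟩

theorem conj_mem_cone_matrix {X : Matrix ι ι (Matrix m m ℂ)}
    (hX : X ∈ OperatorSystem.cone (S := Matrix m m ℂ) ι) (g : Matrix m m ℂ) :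
    (X.map fun x => gᴴ * x * g) ∈ OperatorSystem.cone (S := Matrix m m ℂ) ι := by
  obtain ⟨Y, rfl⟩ := mem_cone_matrix_iff.1 hX
  refine mem_cone_matrix_iff.2 ⟨Y.map (· * g), ?_⟩
  ext1 i j
  simp only [Matrix.map_apply, Matrix.mul_apply, Matrix.conjTranspose_apply, Finset.mul_sum,
    Finset.sum_mul, Matrix.star_eq_conjTranspose, Matrix.conjTranspose_mul]
  exact Finset.sum_congr rfl fun k _ => by simp only [Matrix.mul_assoc]

end MatrixCones

/-! ### Matrix-valued unital completely positive maps on `U_nc(n)` -/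

section MatrixDilation

open scoped ComplexOrder

variable {n m : ℕ}

/-- The `2 × 2` block matrix with diagonal blocks `1 ⊗ d` and off-diagonal blocks `x`, `xᴴ`. -/
def blockMatrix (d : Matrix (Fin m) (Fin m) ℂ)
    (x : Matrix (Fin n) (Fin n) (Matrix (Fin m) (Fin m) ℂ)) :
    Matrix (Fin n ⊕ Fin n) (Fin n ⊕ Fin n) (Matrix (Fin m) (Fin m) ℂ) :=
  Matrix.fromBlocks (Matrix.diagonal fun _ => d) x xᴴ (Matrix.diagonal fun _ => d)

theorem exists_ucp_of_blockMatrix_one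
    {c : Matrix (Fin n) (Fin n) (Matrix (Fin m) (Fin m) ℂ)}
    (hc : blockMatrix 1 c ∈ OperatorSystem.cone (S := Matrix (Fin m) (Fin m) ℂ) (Fin n ⊕ Fin n)) :
    ∃ φ : Unc.{u} n →ₗ[ℂ] Matrix (Fin m) (Fin m) ℂ, IsUCP φ ∧
      ∀ i j, φ (Unc.gen n i j) = c i j := by
  obtain ⟨Y, hY⟩ := mem_cone_matrix_iff.1 hc
  obtain ⟨ψ, hψ, hψc⟩ := exists_ucp_of_fromBlocks_mem_cone.{u}
    (A := CStarMatrix (Fin m) (Fin m) ℂ) (c := c)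
    ⟨Y, hY⟩
  refine ⟨(CStarMatrix.ofMatrixₗ (R := ℂ)).symm.toLinearMap ∘ₗ ψ, ⟨?_, ?_⟩, hψc⟩
  · have h : (CStarMatrix.ofMatrixₗ (R := ℂ)).symm (ψ OperatorSystem.unit) =
        (1 : Matrix (Fin m) (Fin m) ℂ) := hψ.1
    rw [LinearMap.comp_apply, LinearEquiv.coe_coe, h, ← Matrix.diagonal_one]
    rfl
  · intro ι _ X hX
    obtain ⟨Z, hZ⟩ := hψ.2 ι X hX
    exact mem_cone_matrix_iff.2 ⟨Z, hZ⟩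

/-- A congruence by `1 ⊗ h` normalizes the diagonal blocks `1 ⊗ hᴴ h` of a positive block matrix,
so that the off-diagonal block becomes a contraction. -/
theorem exists_ucp_of_blockMatrix {h : Matrix (Fin m) (Fin m) ℂ} (hh : IsUnit h)
    {x : Matrix (Fin n) (Fin n) (Matrix (Fin m) (Fin m) ℂ)}
    (hx : blockMatrix (hᴴ * h) x ∈
      OperatorSystem.cone (S := Matrix (Fin m) (Fin m) ℂ) (Fin n ⊕ Fin n)) :
    ∃ φ : Unc.{u} n →ₗ[ℂ] Matrix (Fin m) (Fin m) ℂ, IsUCP φ ∧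
      ∀ i j, hᴴ * φ (Unc.gen n i j) * h = x i j := by
  obtain ⟨⟨h, g, h1, h2⟩, rfl⟩ := hh
  change blockMatrix (hᴴ * h) x ∈ _ at hx
  have h1' : gᴴ * hᴴ = 1 := by rw [← Matrix.conjTranspose_mul, h1, Matrix.conjTranspose_one]
  have h2' : hᴴ * gᴴ = 1 := by rw [← Matrix.conjTranspose_mul, h2, Matrix.conjTranspose_one]
  have key : (blockMatrix (hᴴ * h) x).map (fun z => gᴴ * z * g) =
      blockMatrix 1 (x.map fun z => gᴴ * z * g) := by
    have h3 : gᴴ * (hᴴ * h) * g = 1 := by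
      rw [← Matrix.mul_assoc, h1', Matrix.one_mul, h1]
    rw [blockMatrix, Matrix.fromBlocks_map, Matrix.diagonal_map (by simp), h3, blockMatrix]
    congr 1
    ext1 i j
    simp [Matrix.star_eq_conjTranspose, Matrix.mul_assoc]
  have hc := conj_mem_cone_matrix hx g
  rw [key] at hc
  obtain ⟨φ, hφ, hφc⟩ := exists_ucp_of_blockMatrix_one.{u} hc
  refine ⟨φ, hφ, fun i j => ?_⟩
  change hᴴ * _ * h = _
  rw [hφc, Matrix.map_apply]
  calc hᴴ * (gᴴ * x i j * g) * h = (hᴴ * gᴴ) * x i j * (g * h) := by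
        simp only [Matrix.mul_assoc]
    _ = x i j := by rw [h2', h2, Matrix.one_mul, Matrix.mul_one]

end MatrixDilation

/-! ### Polarization of functionals on finite rank operators -/

section Quadratic

open scoped InnerProductSpace

variable {L : Type*} [NormedAddCommGroup L] [InnerProductSpace ℂ L]

/-- A finitely supported function `c` on a Hilbert space stands for the finite rank operator
`∑ v, c v • |v⟩⟨v|`; this is its quadratic form at `y`. -/
def rankOneSum (y : L) : (L →₀ ℝ) →ₗ[ℝ] ℝ :=
  Finsupp.linearCombination ℝ fun v => Complex.normSq ⟪y, v⟫_ℂ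

theorem rankOneSum_single (y v : L) (t : ℝ) :
    rankOneSum y (Finsupp.single v t) = t * Complex.normSq ⟪y, v⟫_ℂ := by
  simp [rankOneSum]

/-- A functional on finite rank operators which is bounded on the projections onto lines comes
from a bounded operator, by polarization. -/
theorem exists_operator_of_rankOne [CompleteSpace L] (g : (L →₀ ℝ) →ₗ[ℝ] ℝ)
    (hg : ∀ c, (∀ y, rankOneSum y c = 0) → g c = 0) {M : ℝ}
    (hM : ∀ v, |g (Finsupp.single v 1)| ≤ M * ‖v‖ ^ 2) :
    ∃ T : L →L[ℂ] L, ∀ v, ⟪v, T v⟫_ℂ = (g (Finsupp.single v 1) : ℂ) := by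
  let Q : L → ℝ := fun v => g (Finsupp.single v 1)
  have hQ : ∀ v t, g (Finsupp.single v t) = t * Q v := by
    intro v t
    rw [← smul_eq_mul, ← map_smul, Finsupp.smul_single, smul_eq_mul, mul_one]
  -- identities between rank one operators become identities between values of `Q`
  have hadd : ∀ x x' y, Q (x + x' + y) - Q (x + x' - y) =
      (Q (x + y) - Q (x - y)) + (Q (x' + y) - Q (x' - y)) := by
    intro x x' y
    have := hg (Finsupp.single (x + x' + y) 1 - Finsupp.single (x + x' - y) 1
      - (Finsupp.single (x + y) 1 - Finsupp.single (x - y) 1)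
      - (Finsupp.single (x' + y) 1 - Finsupp.single (x' - y) 1)) (by
        intro z
        simp only [map_sub, rankOneSum_single, inner_add_right, inner_sub_right,
          Complex.normSq_apply, Complex.add_re, Complex.add_im, Complex.sub_re, Complex.sub_im]
        ring)
    simp only [map_sub, hQ] at this
    linarith
  have hsmul : ∀ (t : ℝ) x y, Q ((t : ℂ) • x + y) - Q ((t : ℂ) • x - y) =
      t * (Q (x + y) - Q (x - y)) := by
    intro t x y
    have := hg (Finsupp.single ((t : ℂ) • x + y) 1 - Finsupp.single ((t : ℂ) • x - y) 1
      - (Finsupp.single (x + y) t - Finsupp.single (x - y) t)) (by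
        intro z
        simp only [map_sub, rankOneSum_single, inner_add_right, inner_sub_right,
          inner_smul_right, Complex.normSq_apply, Complex.add_re, Complex.add_im, Complex.sub_re,
          Complex.sub_im, Complex.re_ofReal_mul, Complex.im_ofReal_mul]
        ring)
    simp only [map_sub, hQ] at this
    linarith
  have hI : ∀ x y, Q (Complex.I • x + y) - Q (Complex.I • x - y) =
      -(Q (x + Complex.I • y) - Q (x - Complex.I • y)) := by
    intro x y
    have := hg (Finsupp.single (Complex.I • x + y) 1 - Finsupp.single (Complex.I • x - y) 1
      + (Finsupp.single (x + Complex.I • y) 1 - Finsupp.single (x - Complex.I • y) 1)) (by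
        intro z
        simp only [map_sub, map_add, rankOneSum_single, inner_add_right, inner_sub_right,
          inner_smul_right, Complex.normSq_apply, Complex.add_re, Complex.add_im, Complex.sub_re,
          Complex.sub_im, Complex.I_mul_re, Complex.I_mul_im]
        ring)
    simp only [map_sub, map_add, hQ] at this
    linarith
  have hsymm : ∀ x y, Q (x - y) = Q (y - x) := by
    intro x y
    have := hg (Finsupp.single (x - y) 1 - Finsupp.single (y - x) 1) (by
        intro z
        simp only [map_sub, rankOneSum_single, inner_sub_right, Complex.normSq_apply,
          Complex.sub_re, Complex.sub_im]
        ring)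
    simp only [map_sub, hQ] at this
    linarith
  have hdiag : ∀ x, Q (x + x) - Q (x - x) = 4 * Q x := by
    intro x
    have := hg (Finsupp.single (x + x) 1 - Finsupp.single (x - x) 1 - Finsupp.single x 4) (by
        intro z
        simp only [map_sub, rankOneSum_single, inner_sub_right, inner_add_right,
          Complex.normSq_apply, Complex.sub_re, Complex.sub_im, Complex.add_re, Complex.add_im]
        ring)
    simp only [map_sub, hQ] at this
    linarith
  -- the real part of the sesquilinear form
  let a : L → L → ℝ := fun x y => (Q (x + y) - Q (x - y)) / 4
  have a_symm : ∀ x y, a x y = a y x := by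
    intro x y
    simp only [a]
    rw [add_comm, hsymm]
  have a_add : ∀ x x' y, a (x + x') y = a x y + a x' y := by
    intro x x' y
    simp only [a]
    linarith [hadd x x' y]
  have a_smul : ∀ (t : ℝ) x y, a ((t : ℂ) • x) y = t * a x y := by
    intro t x y
    simp only [a]
    linarith [hsmul t x y]
  have a_I : ∀ x y, a (Complex.I • x) y = -a x (Complex.I • y) := by
    intro x y
    simp only [a]
    linarith [hI x y]
  have a_smulC : ∀ (z : ℂ) x y, a (z • x) y = z.re * a x y + z.im * a (Complex.I • x) y := by
    intro z x y
    conv_lhs => rw [← Complex.re_add_im z, add_smul, a_add, mul_smul, a_smul, a_smul]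
  have a_self : ∀ x, a x x = Q x := by
    intro x
    simp only [a]
    linarith [hdiag x]
  have a_self_I : ∀ x, a x (Complex.I • x) = 0 := by
    intro x
    linarith [a_I x x, a_symm x (Complex.I • x)]
  have a_II : ∀ x y, a (Complex.I • x) (Complex.I • y) = a x y := by
    intro x y
    rw [a_I, smul_smul, Complex.I_mul_I, a_symm, a_smulC]
    simpa using a_symm y x
  have a_smulC_right : ∀ (z : ℂ) x y, a x (z • y) = z.re * a x y + z.im * a x (Complex.I • y) := by
    intro z x y
    rw [a_symm, a_smulC, a_symm y, a_symm _ x]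
  have a_le : ∀ x y, |a x y| ≤ M * (‖x‖ ^ 2 + ‖y‖ ^ 2) / 2 := by
    intro x y
    have h1 := abs_sub (Q (x + y)) (Q (x - y))
    have h2 := congrArg (M * ·) (parallelogram_law_with_norm ℂ x y)
    have h3 : |Q (x + y)| ≤ M * ‖x + y‖ ^ 2 := hM (x + y)
    have h4 : |Q (x - y)| ≤ M * ‖x - y‖ ^ 2 := hM (x - y)
    simp only [a, abs_div]
    rw [div_le_iff₀ (by norm_num)]
    rw [abs_of_pos (by norm_num : (0 : ℝ) < 4)]
    beta_reduce at h2
    linarith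
  -- the sesquilinear form, conjugate linear in the first variable
  let b : L → L → ℂ := fun x y => a x y - Complex.I * a x (Complex.I • y)
  have b_add_left : ∀ x x' y, b (x + x') y = b x y + b x' y := by
    intro x x' y
    simp only [b, a_add]
    push_cast
    ring
  have b_add_right : ∀ x y y', b x (y + y') = b x y + b x y' := by
    intro x y y'
    simp only [b, smul_add]
    rw [a_symm x (y + y'), a_symm x (_ + _), a_add, a_add, a_symm y, a_symm y',
      a_symm (Complex.I • y), a_symm (Complex.I • y')]
    push_cast
    ring
  have b_smul_left : ∀ (z : ℂ) x y, b (z • x) y = (starRingEnd ℂ) z * b x y := by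
    intro z x y
    simp only [b]
    rw [a_smulC z x y, a_smulC z x (Complex.I • y), a_II, a_I]
    apply Complex.ext <;> simp <;> ring
  have b_smul_right : ∀ (z : ℂ) x y, b x (z • y) = z * b x y := by
    intro z x y
    simp only [b]
    rw [a_smulC_right z, smul_smul, a_smulC_right (Complex.I * z)]
    apply Complex.ext <;> simp
  have b_le' : ∀ x y, ‖b x y‖ ≤ M * (‖x‖ ^ 2 + ‖y‖ ^ 2) := by
    intro x y
    refine (norm_sub_le _ _).trans ?_
    rw [norm_mul, Complex.norm_I, one_mul, Complex.norm_real, Complex.norm_real]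
    have h1 := a_le x y
    have h2 := a_le x (Complex.I • y)
    rw [norm_smul, Complex.norm_I, one_mul] at h2
    simp only [Real.norm_eq_abs]
    linarith
  have b_le : ∀ x y, ‖b x y‖ ≤ 2 * M * ‖x‖ * ‖y‖ := by
    intro x y
    rcases eq_or_ne y 0 with rfl | hy
    · have : b x 0 = 0 := by simpa using b_smul_right 0 x 0
      simp [this]
    rcases eq_or_ne x 0 with rfl | hx
    · have : b 0 y = 0 := by simpa using b_smul_left 0 0 y
      simp [this]
    have hx' := norm_pos_iff.2 hx
    have hy' := norm_pos_iff.2 hy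
    -- rescale so that both vectors have the same norm
    have h := b_le' x (((‖x‖ / ‖y‖ : ℝ) : ℂ) • y)
    rw [b_smul_right, norm_mul, norm_smul, Complex.norm_real, Real.norm_eq_abs,
      abs_of_pos (div_pos hx' hy'), div_mul_cancel₀ _ hy'.ne', div_mul_eq_mul_div,
      div_le_iff₀ hy'] at h
    refine le_of_mul_le_mul_left (h.trans (le_of_eq ?_)) hx'
    ring
  let β : L →L⋆[ℂ] L →L[ℂ] ℂ :=
    LinearMap.mkContinuous₂ (LinearMap.mk₂'ₛₗ (starRingEnd ℂ) (RingHom.id ℂ) b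
      b_add_left b_smul_left b_add_right b_smul_right) (2 * M) b_le
  refine ⟨InnerProductSpace.continuousLinearMapOfBilin β, fun v => ?_⟩
  rw [← inner_conj_symm, InnerProductSpace.continuousLinearMapOfBilin_apply]
  change (starRingEnd ℂ) (b v v) = _
  simp [b, a_self, a_self_I, Q]

end Quadratic

/-! ### Positive pencils and operators with constant diagonal -/

section Core

open scoped InnerProductSpace ComplexOrder

variable {K : Type*} [NormedAddCommGroup K] [InnerProductSpace ℂ K] {n : ℕ}

/-- The operators `S₀`, `B i j`, `C i j` on a Hilbert space define a positive element
`1 ⊗ S₀ + ∑ u_{ij}/2n ⊗ B i j + ∑ u_{ji}^*/2n ⊗ C i j`, tested on all matrix states of the first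
factor and all finite families of vectors. -/
def IsPositivePencil (S₀ : K →L[ℂ] K) (B C : Fin n → Fin n → K →L[ℂ] K) : Prop :=
  ∀ (r : ℕ) (φ : Unc.{u} n →ₗ[ℂ] Matrix (Fin r) (Fin r) ℂ), IsUCP φ → ∀ ξ : Fin r → K,
    0 ≤ ∑ ρ, ⟪ξ ρ, S₀ (ξ ρ)⟫_ℂ
      + ∑ i, ∑ j, (1 / (2 * n) : ℂ) *
          ∑ ρ, ∑ σ, φ (Unc.gen n i j) ρ σ * ⟪ξ ρ, B i j (ξ σ)⟫_ℂ
      + ∑ i, ∑ j, (1 / (2 * n) : ℂ) *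
          ∑ ρ, ∑ σ, φ (star (Unc.gen n j i)) ρ σ * ⟪ξ ρ, C i j (ξ σ)⟫_ℂ

/-- The scalar contraction with the single nonzero entry `t`, where `|t| ≤ 1`. -/
theorem exists_ucp_single (i j : Fin n) {t : ℂ} (ht : Complex.normSq t ≤ 1) :
    ∃ φ : Unc.{u} n →ₗ[ℂ] Matrix (Fin 1) (Fin 1) ℂ, IsUCP φ ∧
      ∀ k l, φ (Unc.gen n k l) = if k = i ∧ l = j then Matrix.of fun _ _ => t else 0 := by
  refine exists_ucp_of_blockMatrix_one.{u}
    (c := Matrix.of fun k l => if k = i ∧ l = j then Matrix.of fun _ _ => t else 0) ?_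
  have hs : ((Real.sqrt (1 - Complex.normSq t) : ℝ) : ℂ) * (Real.sqrt (1 - Complex.normSq t) : ℝ)
      = 1 - (starRingEnd ℂ) t * t := by
    rw [← Complex.ofReal_mul, Real.mul_self_sqrt (by linarith), ← Complex.normSq_eq_conj_mul_self]
    push_cast
    rfl
  set s : ℂ := ((Real.sqrt (1 - Complex.normSq t) : ℝ) : ℂ) with hsdef
  -- the Cholesky factor of the block matrix
  refine mem_cone_matrix_iff.2 ⟨Matrix.fromBlocks 1
    (Matrix.of fun k l => if k = i ∧ l = j then Matrix.of fun _ _ => t else 0) 0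
    (Matrix.diagonal fun k => if k = j then Matrix.of fun _ _ => s else 1), ?_⟩
  rw [Matrix.fromBlocks_conjTranspose, Matrix.fromBlocks_multiply, blockMatrix]
  congr 1
  · simp
  · simp
  · simp
  · ext k l a b
    fin_cases a
    fin_cases b
    by_cases hk : k = j <;> by_cases hl : l = j <;> by_cases hkl : k = l <;>
      simp_all [Matrix.mul_apply]

theorem sum_comm_pairs {α β M : Type*} [Fintype α] [Fintype β] [AddCommMonoid M]
    (F : α → α → β → β → M) :
    ∑ ρ, ∑ σ, ∑ a, ∑ b, F ρ σ a b = ∑ a, ∑ b, ∑ ρ, ∑ σ, F ρ σ a b := by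
  simp only [← Fintype.sum_prod_type' (f := fun a b => F _ _ a b),
    ← Fintype.sum_prod_type' (f := fun ρ σ => ∑ x : β × β, F ρ σ x.1 x.2)]
  rw [Finset.sum_comm]
  simp only [Fintype.sum_prod_type]

/-- Pairing `M` with the vectors `∑ h ρ a • e a` amounts to pairing `hᴴ M h` with the vectors
`e a`. -/
theorem sum_conj_inner {m : ℕ} (h M : Matrix (Fin m) (Fin m) ℂ) (e : Fin m → K)
    (T : K →L[ℂ] K) :
    ∑ ρ, ∑ σ, M ρ σ * ⟪∑ a, h ρ a • e a, T (∑ b, h σ b • e b)⟫_ℂ =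
      ∑ a, ∑ b, (hᴴ * M * h) a b * ⟪e a, T (e b)⟫_ℂ := by
  have h1 : ∀ ρ σ, M ρ σ * ⟪∑ a, h ρ a • e a, T (∑ b, h σ b • e b)⟫_ℂ =
      ∑ a, ∑ b, star (h ρ a) * M ρ σ * h σ b * ⟪e a, T (e b)⟫_ℂ := by
    intro ρ σ
    simp only [map_sum, map_smul, sum_inner, inner_sum, inner_smul_left, inner_smul_right,
      Finset.mul_sum]
    rw [Finset.sum_comm]
    refine Finset.sum_congr rfl fun a _ => Finset.sum_congr rfl fun b _ => ?_
    simp only [RCLike.star_def]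
    ring
  simp only [h1]
  rw [sum_comm_pairs]
  refine Finset.sum_congr rfl fun a _ => Finset.sum_congr rfl fun b _ => ?_
  simp only [Matrix.mul_apply, Matrix.conjTranspose_apply, Finset.sum_mul]
  rw [Finset.sum_comm]

/-- The pencil evaluated at the scalar contraction with single entry `t` is real. -/
theorem IsPositivePencil.im_eq_zero {S₀ : K →L[ℂ] K} {B C : Fin n → Fin n → K →L[ℂ] K}
    (h : IsPositivePencil.{u} S₀ B C) (i j : Fin n) {t : ℂ} (ht : Complex.normSq t ≤ 1) (ξ : K) :
    (⟪ξ, S₀ ξ⟫_ℂ + (1 / (2 * n) : ℂ) * (t * ⟪ξ, B i j ξ⟫_ℂ)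
      + (1 / (2 * n) : ℂ) * ((starRingEnd ℂ) t * ⟪ξ, C j i ξ⟫_ℂ)).im = 0 := by
  obtain ⟨φ, hφ, hφt⟩ := exists_ucp_single.{u} i j ht
  have key := (Complex.nonneg_iff.1 (h 1 φ hφ fun _ => ξ)).2.symm
  simp only [Finset.univ_unique, Finset.sum_singleton, hφ.map_star, hφt] at key
  rw [← key]
  congr 3
  · rw [Finset.sum_eq_single i, Finset.sum_eq_single j]
    · simp
    · intro l _ hl
      simp [hl]
    · simp
    · intro k _ hk
      simp [hk]
    · simp
  · rw [Finset.sum_eq_single j, Finset.sum_eq_single i]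
    · simp
    · intro l _ hl
      simp [hl]
    · simp
    · intro k _ hk
      simp [hk]
    · simp

/-- A positive pencil is self-adjoint; this is read off from the scalar contractions with a single
entry `0`, `1` or `i`. -/
theorem IsPositivePencil.isHermitian [CompleteSpace K] {S₀ : K →L[ℂ] K}
    {B C : Fin n → Fin n → K →L[ℂ] K}
    (h : IsPositivePencil.{u} S₀ B C) (i j : Fin n) (ξ : K) :
    (⟪ξ, S₀ ξ⟫_ℂ).im = 0 ∧ C j i = (B i j).adjoint := by
  have hn : (n : ℝ) ≠ 0 := by
    have := i.pos
    positivity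
  have key : ∀ ξ, (⟪ξ, S₀ ξ⟫_ℂ).im = 0 ∧ ⟪ξ, C j i ξ⟫_ℂ = (starRingEnd ℂ) ⟪ξ, B i j ξ⟫_ℂ := by
    intro ξ
    have hc : (1 / (2 * n) : ℂ) = ((1 / (2 * n) : ℝ) : ℂ) := by push_cast; rfl
    have h0 := h.im_eq_zero i j (t := 0) (by simp) ξ
    have h1 := h.im_eq_zero i j (t := 1) (by simp) ξ
    have h2 := h.im_eq_zero i j (t := Complex.I) (by simp) ξ
    have hd : (1 / (2 * n) : ℝ) ≠ 0 := by positivity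
    rw [hc] at h0 h1 h2
    generalize (1 / (2 * n) : ℝ) = d at h0 h1 h2 hd
    simp only [zero_mul, mul_zero, map_zero, add_zero, one_mul, map_one, Complex.add_im,
      Complex.im_ofReal_mul, Complex.conj_I, Complex.I_mul_im, neg_mul, Complex.neg_im] at h0 h1 h2
    rw [h0, zero_add] at h1 h2
    refine ⟨h0, Complex.ext ?_ ?_⟩
    · rw [Complex.conj_re]
      exact mul_left_cancel₀ hd (by linarith)
    · rw [Complex.conj_im]
      exact mul_left_cancel₀ hd (by linarith)
  refine ⟨(key ξ).1, ContinuousLinearMap.coe_injective ((ext_inner_map _ _).1 fun x => ?_)⟩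
  rw [ContinuousLinearMap.coe_coe, ContinuousLinearMap.coe_coe,
    ContinuousLinearMap.adjoint_inner_left, ← inner_conj_symm, (key x).2, Complex.conj_conj]

/-- The space on which the `2n × 2n` operator matrices over `K` act. -/
abbrev BlockSpace (K : Type*) (n : ℕ) := PiLp 2 fun _ : Fin n ⊕ Fin n => K

/-- The `(k, l)` block of the finite rank operator `∑ v, c v • |v⟩⟨v|`, as a form on `K`. -/
def blockForm (k l : Fin n ⊕ Fin n) (x y : K) : (BlockSpace K n →₀ ℝ) →ₗ[ℝ] ℂ :=
  Finsupp.linearCombination ℝ fun v => ⟪x, v k⟫_ℂ * ⟪v l, y⟫_ℂ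

theorem blockForm_single (k l : Fin n ⊕ Fin n) (x y : K) (v : BlockSpace K n) (t : ℝ) :
    blockForm k l x y (Finsupp.single v t) = t * (⟪x, v k⟫_ℂ * ⟪v l, y⟫_ℂ) := by
  simp [blockForm]

theorem conj_blockForm (k l : Fin n ⊕ Fin n) (x y : K) (c : BlockSpace K n →₀ ℝ) :
    (starRingEnd ℂ) (blockForm k l x y c) = blockForm l k y x c := by
  simp only [blockForm, Finsupp.linearCombination_apply, Finsupp.sum, map_sum]
  refine Finset.sum_congr rfl fun v _ => ?_
  simp [mul_comm]

/-- The finite rank operators whose diagonal `n × n` blocks are both of the form `1 ⊗ d`. -/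
def constantDiagonal (K : Type*) [NormedAddCommGroup K] [InnerProductSpace ℂ K] (n : ℕ) :
    Submodule ℝ (BlockSpace K n →₀ ℝ) where
  carrier := {c | ∀ x y, (∀ i j : Fin n, i ≠ j → blockForm (Sum.inl i) (Sum.inl j) x y c = 0 ∧
    blockForm (Sum.inr i) (Sum.inr j) x y c = 0) ∧ ∀ k l, blockForm k k x y c = blockForm l l x y c}
  zero_mem' := by simp
  add_mem' := by
    intro c c' h h' x y
    refine ⟨fun i j hij => ⟨?_, ?_⟩, fun k l => ?_⟩
    · rw [map_add, ((h x y).1 i j hij).1, ((h' x y).1 i j hij).1, add_zero]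
    · rw [map_add, ((h x y).1 i j hij).2, ((h' x y).1 i j hij).2, add_zero]
    · rw [map_add, map_add, (h x y).2 k l, (h' x y).2 k l]
  smul_mem' := by
    intro t c h x y
    refine ⟨fun i j hij => ⟨?_, ?_⟩, fun k l => ?_⟩
    · rw [map_smul, ((h x y).1 i j hij).1, smul_zero]
    · rw [map_smul, ((h x y).1 i j hij).2, smul_zero]
    · rw [map_smul, map_smul, (h x y).2 k l]

/-- The functional `X ↦ tr (X T)`, where `T` has the diagonal blocks `S₀` and the off-diagonal
blocks `B` and `B^*`. -/
def pencilForm (S₀ : K →L[ℂ] K) (B : Fin n → Fin n → K →L[ℂ] K) :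
    (BlockSpace K n →₀ ℝ) →ₗ[ℝ] ℝ :=
  Finsupp.linearCombination ℝ fun v => (∑ k, ⟪v k, S₀ (v k)⟫_ℂ
    + 2 * ∑ i, ∑ j, ⟪v (Sum.inl i), B i j (v (Sum.inr j))⟫_ℂ).re

theorem sum_inner_eq_blockForm {m : ℕ} (e : Fin m → K) (c : BlockSpace K n →₀ ℝ)
    (he : ∀ v ∈ c.support, ∀ k, v k = ∑ a, ⟪e a, v k⟫_ℂ • e a) (k l : Fin n ⊕ Fin n)
    (T : K →L[ℂ] K) :
    c.sum (fun v t => (t : ℂ) * ⟪v k, T (v l)⟫_ℂ) =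
      ∑ a, ∑ b, blockForm l k (e b) (e a) c * ⟪e a, T (e b)⟫_ℂ := by
  simp only [blockForm, Finsupp.linearCombination_apply, Finsupp.sum, Finset.sum_mul]
  rw [Finset.sum_comm_cycle]
  refine Finset.sum_congr rfl fun v hv => ?_
  conv_lhs => rw [he v hv k, he v hv l]
  simp only [map_sum, map_smul, sum_inner, inner_sum, inner_smul_left, inner_smul_right,
    Finset.mul_sum]
  rw [Finset.sum_comm]
  refine Finset.sum_congr rfl fun a _ => Finset.sum_congr rfl fun b _ => ?_
  rw [inner_conj_symm, Complex.real_smul]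
  ring

/-- Finitely many vectors lie in the span of a finite orthonormal family. -/
theorem exists_orthonormal_expansion (s : Set K) (hs : s.Finite) :
    ∃ (m : ℕ) (e : Fin m → K), Orthonormal ℂ e ∧ ∀ w ∈ s, w = ∑ a, ⟪e a, w⟫_ℂ • e a := by
  have := FiniteDimensional.span_of_finite ℂ hs
  let b := stdOrthonormalBasis ℂ (Submodule.span ℂ s)
  refine ⟨_, fun a => (b a : K), b.orthonormal.comp_linearIsometry
    (Submodule.span ℂ s).subtypeₗᵢ, fun w hw => ?_⟩
  have h := congrArg Subtype.val (b.sum_repr ⟨w, Submodule.subset_span hw⟩)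
  simpa [b.repr_apply_apply] using h.symm

/-- The block matrix of a finite rank operator in `constantDiagonal` with respect to a finite
family of vectors. -/
theorem blockMatrix_blockForm {m : ℕ} (e : Fin m → K) {c : BlockSpace K n →₀ ℝ}
    (hc : c ∈ constantDiagonal K n) (k₀ : Fin n ⊕ Fin n) :
    blockMatrix (Matrix.of fun a b => blockForm k₀ k₀ (e b) (e a) c)
      (Matrix.of fun i j => Matrix.of fun a b =>
        blockForm (Sum.inr j) (Sum.inl i) (e b) (e a) c) =
    Matrix.of fun k l => Matrix.of fun a b => blockForm l k (e b) (e a) c := by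
  ext (i | i) (j | j) a b
  · by_cases hij : i = j
    · subst hij
      simpa [blockMatrix] using (hc (e b) (e a)).2 _ _
    · simpa [blockMatrix, hij] using (((hc (e b) (e a)).1 j i (Ne.symm hij)).1).symm
  · simp [blockMatrix]
  · simp [blockMatrix, conj_blockForm]
  · by_cases hij : i = j
    · subst hij
      simpa [blockMatrix] using (hc (e b) (e a)).2 _ _
    · simpa [blockMatrix, hij] using (((hc (e b) (e a)).1 j i (Ne.symm hij)).2).symm

/-- The block matrix of a positive finite rank operator is positive. -/
theorem blockForm_mem_cone {m : ℕ} (e : Fin m → K) {c : BlockSpace K n →₀ ℝ}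
    (hc : ∀ y, 0 ≤ rankOneSum y c) :
    (Matrix.of fun k l => Matrix.of fun a b => blockForm l k (e b) (e a) c) ∈
      OperatorSystem.cone (S := Matrix (Fin m) (Fin m) ℂ) (Fin n ⊕ Fin n) := by
  refine mem_cone_complex_iff.2 (Matrix.PosSemidef.of_dotProduct_mulVec_nonneg ?_ fun ζ => ?_)
  · ext ⟨k, a⟩ ⟨l, b⟩
    simp [conj_blockForm]
  · have h := hc (WithLp.toLp 2 fun k => ∑ a, star (ζ (k, a)) • e a)
    have hp : ∀ v : BlockSpace K n, ⟪(WithLp.toLp 2 fun k => ∑ a, star (ζ (k, a)) • e a :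
        BlockSpace K n), v⟫_ℂ = ∑ p : (Fin n ⊕ Fin n) × Fin m, ζ p * ⟪e p.2, v p.1⟫_ℂ := by
      intro v
      simp [PiLp.inner_apply, sum_inner, inner_smul_left, Fintype.sum_prod_type]
    convert Complex.zero_le_real.2 h using 1
    simp only [rankOneSum, blockForm, Finsupp.linearCombination_apply, Finsupp.sum, dotProduct,
      Matrix.mulVec, Matrix.comp_apply, Matrix.of_apply, Finset.sum_mul, Finset.mul_sum, hp]
    rw [Finset.sum_comm_cycle]
    push_cast
    refine Finset.sum_congr rfl fun v _ => ?_
    rw [smul_eq_mul, Complex.ofReal_mul, Complex.normSq_eq_conj_mul_self, map_sum,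
      Finset.sum_mul_sum, Finset.mul_sum]
    refine Finset.sum_congr rfl fun p _ => ?_
    rw [Finset.mul_sum]
    refine Finset.sum_congr rfl fun q _ => ?_
    rw [map_mul, inner_conj_symm, Complex.real_smul, Pi.star_apply, RCLike.star_def]
    ring

theorem pencilForm_apply (S₀ : K →L[ℂ] K) (B : Fin n → Fin n → K →L[ℂ] K)
    (c : BlockSpace K n →₀ ℝ) :
    pencilForm S₀ B c = (∑ k, c.sum (fun v t => (t : ℂ) * ⟪v k, S₀ (v k)⟫_ℂ)
      + 2 * ∑ i, ∑ j, c.sum fun v t =>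
        (t : ℂ) * ⟪v (Sum.inl i), B i j (v (Sum.inr j))⟫_ℂ).re := by
  simp only [pencilForm, Finsupp.linearCombination_apply, Finsupp.sum]
  rw [Finset.sum_comm, Finset.sum_comm_cycle, Finset.mul_sum, ← Finset.sum_add_distrib,
    Complex.re_sum]
  refine Finset.sum_congr rfl fun v _ => ?_
  rw [smul_eq_mul, ← Complex.re_ofReal_mul]
  simp only [Finset.mul_sum, mul_add, mul_left_comm]

theorem Matrix.PosSemidef.exists_isUnit_factor {m : ℕ} {d : Matrix (Fin m) (Fin m) ℂ}
    (hd : d.PosSemidef) {δ : ℝ} (hδ : 0 < δ) :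
    ∃ h : Matrix (Fin m) (Fin m) ℂ, IsUnit h ∧ d + (δ : ℂ) • 1 = hᴴ * h := by
  have hd' : (d + (δ : ℂ) • 1).PosDef :=
    Matrix.PosDef.posSemidef_add hd (Matrix.PosDef.one.smul (Complex.zero_lt_real.2 hδ))
  obtain ⟨h, hh⟩ := exists_conjTranspose_mul_self hd'.posSemidef
  refine ⟨h, ?_, hh⟩
  have hu := hd'.isUnit
  rw [hh] at hu
  exact isUnit_of_mul_isUnit_right hu

/-- The pencil functional is nonnegative on positive operators with constant diagonal: such an
operator is, up to a congruence, the value at the universal unitary of a matrix state. -/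
theorem IsPositivePencil.pencilForm_nonneg [CompleteSpace K] {S₀ : K →L[ℂ] K}
    {B C : Fin n → Fin n → K →L[ℂ] K} (h : IsPositivePencil.{u} S₀ B C) (hn : 1 ≤ n)
    {c : BlockSpace K n →₀ ℝ} (hc : c ∈ constantDiagonal K n)
    (hpos : ∀ y, 0 ≤ rankOneSum y c) : 0 ≤ pencilForm S₀ B c := by
  obtain ⟨m, e, heo, he⟩ := exists_orthonormal_expansion
    (⋃ v ∈ c.support, Set.range fun k => v k)
    (c.support.finite_toSet.biUnion fun v _ => Set.finite_range _)
  have he' : ∀ v ∈ c.support, ∀ k, v k = ∑ a, ⟪e a, v k⟫_ℂ • e a := fun v hv k =>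
    he _ (Set.mem_biUnion hv ⟨k, rfl⟩)
  have hC : ∀ i j, C i j = (B j i).adjoint := fun i j => (h.isHermitian j i 0).2
  let k₀ : Fin n ⊕ Fin n := Sum.inl ⟨0, hn⟩
  let d : Matrix (Fin m) (Fin m) ℂ := Matrix.of fun a b => blockForm k₀ k₀ (e b) (e a) c
  let x : Matrix (Fin n) (Fin n) (Matrix (Fin m) (Fin m) ℂ) :=
    Matrix.of fun i j => Matrix.of fun a b => blockForm (Sum.inr j) (Sum.inl i) (e b) (e a) c
  have hX : blockMatrix d x ∈ OperatorSystem.cone (S := Matrix (Fin m) (Fin m) ℂ) _ := by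
    rw [blockMatrix_blockForm e hc k₀]
    exact blockForm_mem_cone e hpos
  have hd : d.PosSemidef := by
    have := (mem_cone_complex_iff.1 hX).submatrix fun a => (k₀, a)
    exact this
  have hf : pencilForm S₀ B c = ((2 * n : ℂ) * ∑ a, ∑ b, d a b * ⟪e a, S₀ (e b)⟫_ℂ
      + 2 * ∑ i, ∑ j, ∑ a, ∑ b, x i j a b * ⟪e a, B i j (e b)⟫_ℂ).re := by
    rw [pencilForm_apply]
    simp only [sum_inner_eq_blockForm e c he']
    congr 2
    have h1 : ∀ k, ∑ a, ∑ b, blockForm k k (e b) (e a) c * ⟪e a, S₀ (e b)⟫_ℂ =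
        ∑ a, ∑ b, d a b * ⟪e a, S₀ (e b)⟫_ℂ := fun k =>
      Finset.sum_congr rfl fun a _ => Finset.sum_congr rfl fun b _ => by
        rw [(hc (e b) (e a)).2 k k₀]; rfl
    simp only [h1, Finset.sum_const, Finset.card_univ, Fintype.card_sum, Fintype.card_fin]
    rw [nsmul_eq_mul]
    push_cast
    ring
  -- `d` may be singular: add `δ` to the diagonal, which makes it `gᴴ g` with `g` invertible
  have key : ∀ δ : ℝ, 0 < δ → 0 ≤ pencilForm S₀ B c + δ * (2 * n * ∑ a, ⟪e a, S₀ (e a)⟫_ℂ).re := by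
    intro δ hδ
    obtain ⟨g, hg, hgd⟩ := hd.exists_isUnit_factor hδ
    have hX' : blockMatrix (gᴴ * g) x ∈
        OperatorSystem.cone (S := Matrix (Fin m) (Fin m) ℂ) (Fin n ⊕ Fin n) := by
      have h1 : (1 : Matrix (Fin n ⊕ Fin n) (Fin n ⊕ Fin n) (Matrix (Fin m) (Fin m) ℂ)) ∈
          OperatorSystem.cone (S := Matrix (Fin m) (Fin m) ℂ) (Fin n ⊕ Fin n) :=
        mem_cone_matrix_iff.2 ⟨1, by simp⟩
      convert OperatorSystem.add_mem hX (OperatorSystem.smul_mem hδ.le h1) using 1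
      rw [← hgd, blockMatrix, blockMatrix, ← Matrix.fromBlocks_one, Matrix.fromBlocks_smul,
        Matrix.fromBlocks_add]
      simp [← Matrix.diagonal_one, ← Matrix.diagonal_smul, Matrix.diagonal_add, Pi.smul_def]
    obtain ⟨φ, hφ, hφx⟩ := exists_ucp_of_blockMatrix.{u} hg hX'
    -- test the pencil on `φ` and the vectors `∑ g ρ a • e a`
    have hpos := (Complex.nonneg_iff.1 (h m φ hφ fun ρ => ∑ a, g ρ a • e a)).1
    have t1 : ∑ ρ, ⟪∑ a, g ρ a • e a, S₀ (∑ a, g ρ a • e a)⟫_ℂ =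
        ∑ a, ∑ b, d a b * ⟪e a, S₀ (e b)⟫_ℂ + δ * ∑ a, ⟪e a, S₀ (e a)⟫_ℂ := by
      have := sum_conj_inner g 1 e S₀
      rw [Matrix.mul_one, ← hgd] at this
      simpa [Matrix.one_apply, add_mul, Finset.sum_add_distrib, Finset.mul_sum, mul_ite,
        ite_mul] using this
    let X : Fin n → Fin n → ℂ := fun i j => ∑ a, ∑ b, x i j a b * ⟪e a, B i j (e b)⟫_ℂ
    have hXX : ∑ i, ∑ j, X j i = ∑ i, ∑ j, X i j := Finset.sum_comm
    have t2 : ∀ i j, ∑ ρ, ∑ σ, φ (Unc.gen n i j) ρ σ *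
        ⟪∑ a, g ρ a • e a, B i j (∑ a, g σ a • e a)⟫_ℂ =
        X i j := fun i j => by
      rw [sum_conj_inner, hφx]
    have t3 : ∀ i j, ∑ ρ, ∑ σ, φ (star (Unc.gen n j i)) ρ σ *
        ⟪∑ a, g ρ a • e a, C i j (∑ a, g σ a • e a)⟫_ℂ =
        (starRingEnd ℂ) (X j i) := fun i j => by
      rw [← t2, map_sum, Finset.sum_comm]
      refine Finset.sum_congr rfl fun ρ _ => (Eq.trans ?_ (map_sum _ _ _).symm)
      refine Finset.sum_congr rfl fun σ _ => ?_
      rw [hφ.map_star, hC, map_mul, inner_conj_symm, ContinuousLinearMap.adjoint_inner_right]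
      rfl
    simp only [t1, t2, t3, ← Finset.mul_sum, ← map_sum, hXX] at hpos
    rw [hf]
    change 0 ≤ (_ + 2 * ∑ i, ∑ j, X i j).re + _
    have hc : (1 / (2 * n) : ℂ) = ((1 / (2 * n) : ℝ) : ℂ) := by push_cast; rfl
    have h2 : (2 * n : ℂ) = ((2 * n : ℝ) : ℂ) := by push_cast; rfl
    have h2' : (2 : ℂ) = ((2 : ℝ) : ℂ) := by push_cast; rfl
    rw [hc] at hpos
    rw [h2, h2']
    simp only [Complex.add_re, Complex.re_ofReal_mul, Complex.conj_re] at hpos ⊢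
    have hn' : (0 : ℝ) < 2 * n := by
      have : (0 : ℝ) < n := by exact_mod_cast hn
      positivity
    have := mul_nonneg hn'.le hpos
    field_simp at this
    linarith
  -- let `δ` tend to `0`
  by_contra! hneg
  generalize pencilForm S₀ B c = t at key hneg
  generalize (2 * n * ∑ a, ⟪e a, S₀ (e a)⟫_ℂ).re = E at key
  have hE : 0 < |E| + 1 := by positivity
  have hδ : 0 < -t / (2 * (|E| + 1)) := div_pos (by linarith) (by positivity)
  have h1 : -t / (2 * (|E| + 1)) * (|E| + 1) = -t / 2 := by
    field_simp
  have h2 := mul_le_mul_of_nonneg_left ((le_abs_self E).trans (by linarith : |E| ≤ |E| + 1)) hδ.le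
  linarith [key _ hδ]

end Core

/-! ### Matrices of operators -/

section OperatorMatrices

open scoped InnerProductSpace ComplexOrder

variable {ι : Type*} {H : Type*} [NormedAddCommGroup H] [InnerProductSpace ℂ H]

theorem sum_single_eq {ι H : Type*} [Fintype ι] [DecidableEq ι] [NormedAddCommGroup H]
    (v : PiLp 2 fun _ : ι => H) : ∑ k, PiLp.single 2 k (v k) = v := by
  ext l
  simp [Finset.sum_apply, Pi.single_apply]

/-- The operator on `H^ι` with given entries. -/
def ofBlocks [Fintype ι] (X : Matrix ι ι (H →L[ℂ] H)) :
    PiLp 2 (fun _ : ι => H) →L[ℂ] PiLp 2 fun _ : ι => H :=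
  (PiLp.continuousLinearEquiv 2 ℂ _).symm.toContinuousLinearMap ∘L
    ContinuousLinearMap.pi fun k => ∑ l, X k l ∘L PiLp.proj 2 _ l

theorem ofBlocks_apply [Fintype ι] (X : Matrix ι ι (H →L[ℂ] H)) (v : PiLp 2 fun _ : ι => H)
    (k : ι) : ofBlocks X v k = ∑ l, X k l (v l) := by
  simp [ofBlocks]

variable [DecidableEq ι]

/-- The `(k, l)` entry of an operator on `H^ι`. -/
def blockEntry (T : PiLp 2 (fun _ : ι => H) →L[ℂ] PiLp 2 fun _ : ι => H) (k l : ι) :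
    H →L[ℂ] H :=
  PiLp.proj 2 _ k ∘L T ∘L (PiLp.continuousLinearEquiv 2 ℂ _).symm.toContinuousLinearMap ∘L
    ContinuousLinearMap.single ℂ (fun _ => H) l

theorem blockEntry_apply (T : PiLp 2 (fun _ : ι => H) →L[ℂ] PiLp 2 fun _ : ι => H) (k l : ι)
    (x : H) : blockEntry T k l x = T (PiLp.single 2 l x) k :=
  rfl

variable [Fintype ι]

theorem inner_single_left (k : ι) (x : H) (w : PiLp 2 fun _ : ι => H) :
    ⟪PiLp.single 2 k x, w⟫_ℂ = ⟪x, w k⟫_ℂ := by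
  rw [PiLp.inner_apply, Finset.sum_eq_single k]
  · simp
  · intro l _ hl
    simp [hl]
  · simp

theorem inner_blockEntry (T : PiLp 2 (fun _ : ι => H) →L[ℂ] PiLp 2 fun _ : ι => H) (k l : ι)
    (x y : H) : ⟪x, blockEntry T k l y⟫_ℂ = ⟪PiLp.single 2 k x, T (PiLp.single 2 l y)⟫_ℂ := by
  rw [blockEntry_apply, inner_single_left]

theorem sum_inner_blockEntry (T : PiLp 2 (fun _ : ι => H) →L[ℂ] PiLp 2 fun _ : ι => H)
    (v w : PiLp 2 fun _ : ι => H) :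
    ∑ k, ∑ l, ⟪v k, blockEntry T k l (w l)⟫_ℂ = ⟪v, T w⟫_ℂ := by
  simp only [inner_blockEntry]
  conv_rhs => rw [← sum_single_eq v, ← sum_single_eq w, map_sum]
  simp only [sum_inner, inner_sum]
  exact Finset.sum_comm

theorem blockEntry_ofBlocks (X : Matrix ι ι (H →L[ℂ] H)) (k l : ι) :
    blockEntry (ofBlocks X) k l = X k l := by
  ext x
  rw [blockEntry_apply, ofBlocks_apply, Finset.sum_eq_single l]
  · simp
  · intro j _ hj
    simp [hj]
  · simp

theorem inner_ofBlocks (X : Matrix ι ι (H →L[ℂ] H)) (v w : PiLp 2 fun _ : ι => H) :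
    ⟪v, ofBlocks X w⟫_ℂ = ∑ k, ∑ l, ⟪v k, X k l (w l)⟫_ℂ := by
  rw [← sum_inner_blockEntry]
  simp only [blockEntry_ofBlocks]

theorem blockEntry_adjoint_mul [CompleteSpace H]
    (T : PiLp 2 (fun _ : ι => H) →L[ℂ] PiLp 2 fun _ : ι => H) (k l : ι) :
    blockEntry (T.adjoint ∘L T) k l = ∑ j, star (blockEntry T j k) * blockEntry T j l := by
  ext1 y
  refine ext_inner_left ℂ fun x => ?_
  rw [inner_blockEntry, ContinuousLinearMap.comp_apply, ContinuousLinearMap.adjoint_inner_right,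
    sum_apply, inner_sum, PiLp.inner_apply]
  refine Finset.sum_congr rfl fun j _ => ?_
  rw [mul_apply_eq_comp, ContinuousLinearMap.star_eq_adjoint,
    ContinuousLinearMap.adjoint_inner_right]
  rfl

theorem isPositive_of_inner_nonneg {E : Type*} [NormedAddCommGroup E] [InnerProductSpace ℂ E]
    {T : E →L[ℂ] E} (h : ∀ v, 0 ≤ ⟪v, T v⟫_ℂ) : T.IsPositive := by
  refine (ContinuousLinearMap.isPositive_iff_complex T).2 fun v => ?_
  obtain ⟨h1, h2⟩ := Complex.nonneg_iff.1 (h v)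
  have h3 : ⟪T v, v⟫_ℂ = ⟪v, T v⟫_ℂ := by
    rw [← inner_conj_symm]
    exact Complex.conj_eq_iff_im.2 h2.symm
  rw [h3]
  exact ⟨Complex.ext (by simp) (by simpa using h2), h1⟩

theorem exists_adjoint_comp_self {E : Type*} [NormedAddCommGroup E] [InnerProductSpace ℂ E]
    [CompleteSpace E] {T : E →L[ℂ] E} (h : ∀ v, 0 ≤ ⟪v, T v⟫_ℂ) :
    ∃ Y : E →L[ℂ] E, T = Y.adjoint ∘L Y :=
  CStarAlgebra.nonneg_iff_eq_star_mul_self.1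
    ((ContinuousLinearMap.nonneg_iff_isPositive T).2 (isPositive_of_inner_nonneg h))

/-- A matrix of operators is positive if and only if its quadratic form is nonnegative. -/
theorem mem_cone_operator_iff {ι : Type} [Fintype ι] [CompleteSpace H]
    {X : Matrix ι ι (H →L[ℂ] H)} :
    X ∈ OperatorSystem.cone (S := H →L[ℂ] H) ι ↔
      ∀ v : ι → H, 0 ≤ ∑ k, ∑ l, ⟪v k, X k l (v l)⟫_ℂ := by
  classical
  constructor
  · rintro ⟨Y, rfl⟩ v
    have : ∑ k, ∑ l, ⟪v k, (Yᴴ * Y) k l (v l)⟫_ℂ =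
        ⟪ofBlocks Y (WithLp.toLp 2 v), ofBlocks Y (WithLp.toLp 2 v)⟫_ℂ := by
      simp only [PiLp.inner_apply, ofBlocks_apply, sum_inner, inner_sum, Matrix.mul_apply,
        sum_apply, Matrix.conjTranspose_apply, mul_apply_eq_comp,
        ContinuousLinearMap.star_eq_adjoint, ContinuousLinearMap.adjoint_inner_right]
      rw [Finset.sum_comm_cycle]
      exact Finset.sum_congr rfl fun j _ => Finset.sum_comm
    rw [this]
    exact Complex.nonneg_iff.2 ⟨inner_self_nonneg (𝕜 := ℂ), (inner_self_im (𝕜 := ℂ) _).symm⟩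
  · intro h
    obtain ⟨Y, hY⟩ := exists_adjoint_comp_self (T := ofBlocks X) fun v => by
      rw [inner_ofBlocks]
      exact h v
    refine ⟨Matrix.of fun k l => blockEntry Y k l, ?_⟩
    ext1 k l
    rw [← blockEntry_ofBlocks X, hY]
    exact blockEntry_adjoint_mul Y k l

end OperatorMatrices

/-! ### Extension of the pencil functional -/

section Existence

open scoped InnerProductSpace ComplexOrder

variable {K : Type*} [NormedAddCommGroup K] [InnerProductSpace ℂ K] {n : ℕ}

/-- The operator `1 ⊗ |w⟩⟨w|`. -/
def constantRankOne (n : ℕ) (w : K) : BlockSpace K n →₀ ℝ :=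
  ∑ k, Finsupp.single (PiLp.single 2 k w) 1

theorem constantRankOne_mem (w : K) : constantRankOne n w ∈ constantDiagonal K n := by
  have key : ∀ k l x y, blockForm k l x y (constantRankOne n w) =
      if k = l then ⟪x, w⟫_ℂ * ⟪w, y⟫_ℂ else 0 := by
    intro k l x y
    simp only [constantRankOne, map_sum, blockForm_single]
    rw [Finset.sum_eq_single k]
    · by_cases h : k = l
      · subst h; simp
      · simp [h]
    · intro j _ hj
      simp [hj.symm]
    · simp
  intro x y
  simp only [key]
  exact ⟨fun i j hij => by simp [hij], fun k l => by simp⟩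

theorem rankOneSum_constantRankOne (y : BlockSpace K n) (w : K) :
    rankOneSum y (constantRankOne n w) = ∑ k, Complex.normSq ⟪y k, w⟫_ℂ := by
  simp only [constantRankOne, map_sum, rankOneSum_single]
  refine Finset.sum_congr rfl fun k _ => ?_
  rw [← inner_conj_symm, inner_single_left, Complex.normSq_conj, ← inner_conj_symm,
    Complex.normSq_conj, one_mul]

theorem pencilForm_constantRankOne (S₀ : K →L[ℂ] K) (B : Fin n → Fin n → K →L[ℂ] K) (w : K) :
    pencilForm S₀ B (constantRankOne n w) = 2 * n * (⟪w, S₀ w⟫_ℂ).re := by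
  have h : ∀ k, (∑ l, ⟪(PiLp.single 2 k w : BlockSpace K n) l,
      S₀ ((PiLp.single 2 k w : BlockSpace K n) l)⟫_ℂ + 2 * ∑ i, ∑ j,
      ⟪(PiLp.single 2 k w : BlockSpace K n) (Sum.inl i),
        B i j ((PiLp.single 2 k w : BlockSpace K n) (Sum.inr j))⟫_ℂ) = ⟪w, S₀ w⟫_ℂ := by
    intro k
    rw [Finset.sum_eq_single k, Finset.sum_eq_zero fun i _ => Finset.sum_eq_zero fun j _ => ?_]
    · simp
    · rcases k with k | k <;> simp
    · intro l _ hl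
      simp [hl]
    · simp
  simp only [constantRankOne, pencilForm, map_sum, Finsupp.linearCombination_single, h,
    Finset.sum_const, Finset.card_univ, Fintype.card_sum, Fintype.card_fin, nsmul_eq_mul, one_smul]
  push_cast
  ring

/-- Positive finite rank operators are dominated by operators with constant diagonal. -/
theorem normSq_inner_le (y v : BlockSpace K n) :
    Complex.normSq ⟪y, v⟫_ℂ ≤ 2 * n * rankOneSum y (∑ k, constantRankOne n (v k)) := by
  have h1 : ‖⟪y, v⟫_ℂ‖ ≤ ∑ k, ‖⟪y k, v k⟫_ℂ‖ := by
    rw [PiLp.inner_apply]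
    exact norm_sum_le _ _
  have h2 := sq_sum_le_card_mul_sum_sq (s := Finset.univ) (f := fun k => ‖⟪y k, v k⟫_ℂ‖)
  rw [Finset.card_univ, Fintype.card_sum, Fintype.card_fin] at h2
  rw [← Complex.sq_norm]
  refine ((pow_le_pow_left₀ (norm_nonneg _) h1 2).trans h2).trans ?_
  push_cast
  rw [← two_mul]
  refine mul_le_mul_of_nonneg_left ?_ (by positivity)
  rw [map_sum]
  refine Finset.sum_le_sum fun k _ => ?_
  rw [rankOneSum_constantRankOne, Complex.sq_norm]
  exact Finset.single_le_sum (f := fun l => Complex.normSq ⟪y l, v k⟫_ℂ)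
    (fun l _ => Complex.normSq_nonneg _) (Finset.mem_univ k)

/-- The M. Riesz extension of the pencil functional from the operators with constant diagonal to a
positive functional on all finite rank operators. -/
theorem IsPositivePencil.exists_functional [CompleteSpace K] {S₀ : K →L[ℂ] K}
    {B C : Fin n → Fin n → K →L[ℂ] K} (h : IsPositivePencil.{u} S₀ B C) (hn : 1 ≤ n) :
    ∃ g : (BlockSpace K n →₀ ℝ) →ₗ[ℝ] ℝ,
      (∀ c ∈ constantDiagonal K n, g c = pencilForm S₀ B c) ∧
      ∀ c, (∀ y, 0 ≤ rankOneSum y c) → 0 ≤ g c := by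
  -- the cone of positive finite rank operators
  let s : PointedCone ℝ (BlockSpace K n →₀ ℝ) :=
    { carrier := {c | ∀ y, 0 ≤ rankOneSum y c}
      add_mem' := fun hc hc' y => by
        rw [map_add]
        exact add_nonneg (hc y) (hc' y)
      zero_mem' := fun y => by simp
      smul_mem' := fun t c hc y => by
        change 0 ≤ rankOneSum y ((t : ℝ) • c)
        rw [map_smul]
        exact mul_nonneg t.2 (hc y) }
  -- the domain condition of the extension theorem
  have dense : ∀ c : BlockSpace K n →₀ ℝ, ∃ c' ∈ constantDiagonal K n, c' + c ∈ s := by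
    intro c
    induction c using Finsupp.induction_linear with
    | zero => exact ⟨0, Submodule.zero_mem _, by simp⟩
    | add c₁ c₂ h₁ h₂ =>
      obtain ⟨c₁', h₁, h₁'⟩ := h₁
      obtain ⟨c₂', h₂, h₂'⟩ := h₂
      refine ⟨c₁' + c₂', Submodule.add_mem _ h₁ h₂, ?_⟩
      rw [add_add_add_comm]
      exact add_mem h₁' h₂'
    | single v t =>
      refine ⟨(|t| * (2 * n)) • ∑ k, constantRankOne n (v k), Submodule.smul_mem _ _
        (Submodule.sum_mem _ fun k _ => constantRankOne_mem _), fun y => ?_⟩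
      rw [map_add, map_smul, rankOneSum_single, smul_eq_mul, mul_assoc]
      have h1 := mul_le_mul_of_nonneg_left (normSq_inner_le y v) (abs_nonneg t)
      have h2 := mul_le_mul_of_nonneg_right (neg_abs_le t) (Complex.normSq_nonneg ⟪y, v⟫_ℂ)
      linarith
  obtain ⟨g, hg, hgs⟩ := riesz_extension s
    ⟨constantDiagonal K n, (pencilForm S₀ B).domRestrict _⟩
    (fun c hc => h.pencilForm_nonneg hn c.2 hc) (fun c => by
      obtain ⟨c', h1, h2⟩ := dense c
      exact ⟨⟨c', h1⟩, h2⟩)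
  exact ⟨g, fun c hc => hg ⟨c, hc⟩, hgs⟩

/-- The extended functional is `X ↦ tr (X T)` for a positive operator `T`. -/
theorem IsPositivePencil.exists_operator [CompleteSpace K] {S₀ : K →L[ℂ] K}
    {B C : Fin n → Fin n → K →L[ℂ] K} (h : IsPositivePencil.{u} S₀ B C) (hn : 1 ≤ n) :
    ∃ T : BlockSpace K n →L[ℂ] BlockSpace K n, (∀ v, 0 ≤ ⟪v, T v⟫_ℂ) ∧
      ∀ c ∈ constantDiagonal K n,
        Finsupp.linearCombination ℝ (fun v => ⟪v, T v⟫_ℂ) c = (pencilForm S₀ B c : ℂ) := by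
  obtain ⟨g, hg, hgs⟩ := h.exists_functional hn
  obtain ⟨T, hT⟩ := exists_operator_of_rankOne g (M := 2 * n * (2 * n * ‖S₀‖)) (fun c hc =>
      le_antisymm (by
        have := hgs (-c) fun y => by simp [hc y]
        rwa [map_neg, neg_nonneg] at this) (hgs c fun y => (hc y).ge)) (fun v => by
      have h0 : 0 ≤ g (Finsupp.single v 1) := hgs _ fun y => by
        rw [rankOneSum_single, one_mul]
        exact Complex.normSq_nonneg _
      have h1 := hgs ((2 * n : ℝ) • (∑ k, constantRankOne n (v k)) - Finsupp.single v 1)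
        fun y => by
          rw [map_sub, map_smul, rankOneSum_single, one_mul, smul_eq_mul, sub_nonneg]
          exact normSq_inner_le y v
      rw [map_sub, map_smul, hg _ (Submodule.sum_mem _ fun k _ => constantRankOne_mem _), map_sum,
        sub_nonneg, smul_eq_mul] at h1
      simp only [pencilForm_constantRankOne, ← Finset.mul_sum] at h1
      have hn0 : (0 : ℝ) ≤ 2 * n := by positivity
      rw [abs_of_nonneg h0, mul_assoc (2 * n : ℝ), mul_assoc (2 * n : ℝ)]
      refine h1.trans (mul_le_mul_of_nonneg_left (mul_le_mul_of_nonneg_left ?_ hn0) hn0)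
      rw [PiLp.norm_sq_eq_of_L2, Finset.mul_sum]
      refine Finset.sum_le_sum fun k _ => ?_
      calc (⟪v k, S₀ (v k)⟫_ℂ).re ≤ ‖⟪v k, S₀ (v k)⟫_ℂ‖ := Complex.re_le_norm _
        _ ≤ ‖v k‖ * ‖S₀ (v k)‖ := norm_inner_le_norm _ _
        _ ≤ ‖v k‖ * (‖S₀‖ * ‖v k‖) := by gcongr; exact S₀.le_opNorm _
        _ = ‖S₀‖ * ‖v k‖ ^ 2 := by ring)
  refine ⟨T, fun v => ?_, fun c hc => ?_⟩
  · rw [hT]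
    refine Complex.zero_le_real.2 (hgs _ fun y => ?_)
    rw [rankOneSum_single, one_mul]
    exact Complex.normSq_nonneg _
  · rw [← hg c hc]
    have key : Finsupp.linearCombination ℝ (fun v => ⟪v, T v⟫_ℂ) =
        Complex.ofRealCLM.toLinearMap ∘ₗ g := by
      refine Finsupp.lhom_ext fun v t => ?_
      rw [Finsupp.linearCombination_single, hT, LinearMap.comp_apply, ← mul_one t,
        ← smul_eq_mul, ← Finsupp.smul_single, map_smul, map_smul, smul_eq_mul, mul_one]
      rfl
    exact LinearMap.congr_fun key c

/-- A positive pencil over the operators on a Hilbert space extends to a positive operator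
matrix. -/
theorem IsPositivePencil.exists_matrix [CompleteSpace K] {S₀ : K →L[ℂ] K}
    {B C : Fin n → Fin n → K →L[ℂ] K} (h : IsPositivePencil.{u} S₀ B C) (hn : 1 ≤ n) :
    ∃ T : BlockSpace K n →L[ℂ] BlockSpace K n, (∀ v, 0 ≤ ⟪v, T v⟫_ℂ) ∧
      (∀ i j, blockEntry T (Sum.inl i) (Sum.inr j) = B i j) ∧
      (∀ i j, blockEntry T (Sum.inr i) (Sum.inl j) = C i j) ∧
      ∑ k, blockEntry T k k = (2 * n : ℂ) • S₀ := by
  obtain ⟨T, hT, hTf⟩ := h.exists_operator hn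
  have hTsa : ∀ v w, ⟪v, T w⟫_ℂ = (starRingEnd ℂ) ⟪w, T v⟫_ℂ := fun v w => by
    rw [inner_conj_symm]
    exact ((isPositive_of_inner_nonneg hT).isSymmetric v w).symm
  have hadj : ∀ k l, blockEntry T k l = (blockEntry T l k).adjoint := by
    intro k l
    ext1 y
    refine ext_inner_left ℂ fun x => ?_
    rw [ContinuousLinearMap.adjoint_inner_right, inner_blockEntry, hTsa,
      ← inner_conj_symm (blockEntry T l k x), inner_blockEntry]
  have hre : ∀ i j x y, (⟪x, blockEntry T (Sum.inl i) (Sum.inr j) y⟫_ℂ).re =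
      (⟪x, B i j y⟫_ℂ).re := by
    intro i j x y
    let a : BlockSpace K n := PiLp.single 2 (Sum.inl i) x
    let b : BlockSpace K n := PiLp.single 2 (Sum.inr j) y
    have ha : ∀ k, a (Sum.inr k) = 0 := fun k => by simp [a]
    have hb : ∀ k, b (Sum.inl k) = 0 := fun k => by simp [b]
    -- the operator `2 (|a⟩⟨b| + |b⟩⟨a|)` has vanishing diagonal blocks, so its value is prescribed
    let c : BlockSpace K n →₀ ℝ := Finsupp.single (a + b) 1 - Finsupp.single (a - b) 1
    have hc : c ∈ constantDiagonal K n := by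
      intro x' y'
      have hz : ∀ k l, blockForm k l x' y' c =
          2 * (⟪x', a k⟫_ℂ * ⟪b l, y'⟫_ℂ + ⟪x', b k⟫_ℂ * ⟪a l, y'⟫_ℂ) := by
        intro k l
        simp only [c, map_sub, blockForm_single, PiLp.add_apply, PiLp.sub_apply, inner_add_left,
          inner_add_right, inner_sub_left, inner_sub_right, Complex.ofReal_one]
        ring
      have hz' : ∀ k, blockForm k k x' y' c = 0 := by
        rintro (k | k) <;> simp [hz, ha, hb]
      exact ⟨fun i j _ => by simp [hz, ha, hb], fun k l => by rw [hz', hz']⟩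
    have hs : ∑ k, ∑ l, ⟪a (Sum.inl k), B k l (b (Sum.inr l))⟫_ℂ = ⟪x, B i j y⟫_ℂ := by
      rw [Finset.sum_eq_single i, Finset.sum_eq_single j]
      · simp [a, b]
      · intro l _ hl
        simp [b, hl]
      · simp
      · intro k _ hk
        simp [a, hk]
      · simp
    have hp : pencilForm S₀ B c = 4 * (⟪x, B i j y⟫_ℂ).re := by
      simp only [c, pencilForm, map_sub, Finsupp.linearCombination_single, Fintype.sum_sum_type,
        PiLp.add_apply, PiLp.sub_apply, ha, hb, add_zero, zero_add, sub_zero, zero_sub, map_neg,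
        inner_neg_left, inner_neg_right, neg_neg, Finset.sum_neg_distrib, hs, one_smul]
      simp
      ring
    have h1 := congrArg Complex.re (hTf c hc)
    rw [Complex.ofReal_re, hp] at h1
    simp only [c, map_sub, Finsupp.linearCombination_single, one_smul, map_add, inner_add_left,
      inner_add_right, inner_sub_left, inner_sub_right] at h1
    rw [hTsa b a] at h1
    simp only [Complex.add_re, Complex.sub_re, Complex.conj_re] at h1
    rw [inner_blockEntry]
    linarith
  have hB : ∀ i j, blockEntry T (Sum.inl i) (Sum.inr j) = B i j := by
    intro i j
    ext1 y
    refine ext_inner_left ℂ fun x => Complex.ext (hre i j x y) ?_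
    have := hre i j (Complex.I • x) y
    simpa [inner_smul_left] using this
  -- the trace of the diagonal blocks is prescribed by the operators `1 ⊗ |x⟩⟨x|`
  refine ⟨T, hT, hB, fun i j => ?_, ?_⟩
  · rw [hadj, hB, (h.isHermitian j i 0).2]
  · refine ContinuousLinearMap.coe_injective ((ext_inner_map _ _).1 fun x => ?_)
    have h1 := hTf _ (constantRankOne_mem x)
    rw [pencilForm_constantRankOne] at h1
    simp only [constantRankOne, map_sum, Finsupp.linearCombination_single, one_smul,
      ← inner_blockEntry] at h1
    have h2 : ((⟪x, S₀ x⟫_ℂ).re : ℂ) = ⟪x, S₀ x⟫_ℂ :=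
      Complex.ext (by simp) (by simp [(h.isHermitian ⟨0, hn⟩ ⟨0, hn⟩ x).1])
    push_cast at h1
    rw [h2] at h1
    rw [ContinuousLinearMap.coe_coe, ContinuousLinearMap.coe_coe, ← inner_conj_symm,
      ← inner_conj_symm (((2 * n : ℂ) • S₀) x)]
    congr 1
    simpa [inner_sum, inner_add_right, inner_smul_right] using h1

end Existence

/-! ### Compressions of operators to matrices -/

section Compression

open scoped InnerProductSpace ComplexOrder

variable {K : Type*} [NormedAddCommGroup K] [InnerProductSpace ℂ K] [CompleteSpace K]

/-- The compression of operators to the span of an orthonormal family, as a map into matrices. -/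
def compression {m : ℕ} (e : Fin m → K) : (K →L[ℂ] K) →ₗ[ℂ] Matrix (Fin m) (Fin m) ℂ where
  toFun T := Matrix.of fun a b => ⟪e a, T (e b)⟫_ℂ
  map_add' S T := by
    ext a b
    simp
  map_smul' z T := by
    ext a b
    simp

theorem isUCP_compression {m : ℕ} {e : Fin m → K} (he : Orthonormal ℂ e) :
    IsUCP (compression e) := by
  refine ⟨?_, fun ι _ X hX => ?_⟩
  · ext a b
    change ⟪e a, e b⟫_ℂ = Matrix.diagonal (fun _ => (1 : ℂ)) a b
    rw [orthonormal_iff_ite.1 he, Matrix.diagonal_apply]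
  · obtain ⟨Y, rfl⟩ := hX
    refine mem_cone_complex_iff.2 ?_
    have h : Matrix.comp ι ι (Fin m) (Fin m) ℂ ((Yᴴ * Y).map (compression e)) =
        ∑ k, Matrix.gram ℂ fun p : ι × Fin m => Y k p.1 (e p.2) := by
      ext ⟨i, a⟩ ⟨j, b⟩
      simp [compression, Matrix.mul_apply, Matrix.sum_apply, Matrix.gram,
        ContinuousLinearMap.star_eq_adjoint, ContinuousLinearMap.adjoint_inner_right]
    rw [h]
    exact Matrix.posSemidef_sum _ fun k _ => Matrix.posSemidef_gram ℂ _

theorem IsUCP.comp {S T U : Type*} [AddCommGroup S] [Module ℂ S] [StarAddMonoid S]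
    [StarModule ℂ S] [OperatorSystem S] [AddCommGroup T] [Module ℂ T] [StarAddMonoid T]
    [StarModule ℂ T] [OperatorSystem T] [AddCommGroup U] [Module ℂ U] [StarAddMonoid U]
    [StarModule ℂ U] [OperatorSystem U] {ψ : T →ₗ[ℂ] U} {φ : S →ₗ[ℂ] T} (hψ : IsUCP ψ)
    (hφ : IsUCP φ) : IsUCP (ψ ∘ₗ φ) := by
  refine ⟨?_, fun ι _ X hX => hψ.2 ι _ (hφ.2 ι X hX)⟩
  rw [LinearMap.comp_apply, hφ.1, hψ.1]

/-- The identification of `M_p(B(H))` with the operators on `H^p`. -/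
def ofBlocksₗ (p : Type*) [Fintype p] [DecidableEq p] (H : Type*) [NormedAddCommGroup H]
    [InnerProductSpace ℂ H] :
    Matrix p p (H →L[ℂ] H) →ₗ[ℂ] PiLp 2 (fun _ : p => H) →L[ℂ] PiLp 2 fun _ : p => H where
  toFun := ofBlocks
  map_add' X Y := by
    ext v k
    simp [ofBlocks_apply, Finset.sum_add_distrib]
  map_smul' z X := by
    ext v k
    simp [ofBlocks_apply, Finset.smul_sum]

theorem ofBlocksₗ_apply {p H : Type*} [Fintype p] [DecidableEq p] [NormedAddCommGroup H]
    [InnerProductSpace ℂ H] (X : Matrix p p (H →L[ℂ] H)) : ofBlocksₗ p H X = ofBlocks X :=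
  rfl

theorem isUCP_ofBlocks (p : Type) [Fintype p] [DecidableEq p] (H : Type*) [NormedAddCommGroup H]
    [InnerProductSpace ℂ H] [CompleteSpace H] : IsUCP (ofBlocksₗ p H) := by
  refine ⟨?_, fun ι _ X hX => mem_cone_operator_iff.2 fun v => ?_⟩
  · ext v k
    change ofBlocks (Matrix.diagonal fun _ => 1) v k = v k
    rw [ofBlocks_apply, Finset.sum_eq_single k]
    · simp
    · intro l _ hl
      simp [Ne.symm hl]
    · simp
  · have h := mem_cone_operator_iff.1 hX fun q : ι × p => v q.1 q.2
    convert h using 1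
    simp only [Fintype.sum_prod_type, Matrix.map_apply]
    refine Finset.sum_congr rfl fun i _ => ?_
    rw [Finset.sum_comm]
    refine Finset.sum_congr rfl fun j _ => ?_
    exact inner_ofBlocks (X i j) (v i) (v j)

end Compression

/-! ### The minimal cone and vector functionals -/

section VectorForms

open scoped InnerProductSpace ComplexOrder

variable {S : Type*} [AddCommGroup S] [Module ℂ S] {T : Type*} [AddCommGroup T] [Module ℂ T]
  {K : Type*} [NormedAddCommGroup K] [InnerProductSpace ℂ K]

theorem tensorState_tmul {r q : ℕ} (φ : S →ₗ[ℂ] Matrix (Fin r) (Fin r) ℂ)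
    (ψ : T →ₗ[ℂ] Matrix (Fin q) (Fin q) ℂ) (s : S) (t : T) (a b : Fin r × Fin q) :
    tensorState φ ψ (s ⊗ₜ[ℂ] t) a b = φ s a.1 b.1 * ψ t a.2 b.2 :=
  rfl

/-- The matrix coefficient `s ⊗ t ↦ ⟨ξ, (φ(s) ⊗ ω(t)) η⟩` for `ξ, η ∈ ℂ^r ⊗ K`. -/
def vectorForm {r : ℕ} (φ : S →ₗ[ℂ] Matrix (Fin r) (Fin r) ℂ) (ω : T →ₗ[ℂ] K →L[ℂ] K)
    (ξ η : Fin r → K) : S ⊗[ℂ] T →ₗ[ℂ] ℂ :=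
  TensorProduct.lift <| LinearMap.mk₂ ℂ
    (fun s t => ∑ ρ, ∑ σ, φ s ρ σ * ⟪ξ ρ, ω t (η σ)⟫_ℂ)
    (fun s s' t => by simp [add_mul, Finset.sum_add_distrib])
    (fun z s t => by simp [Finset.mul_sum, mul_assoc])
    (fun s t t' => by simp [mul_add, Finset.sum_add_distrib])
    (fun z s t => by simp [Finset.mul_sum, mul_left_comm])

theorem vectorForm_tmul {r : ℕ} (φ : S →ₗ[ℂ] Matrix (Fin r) (Fin r) ℂ) (ω : T →ₗ[ℂ] K →L[ℂ] K)
    (ξ η : Fin r → K) (s : S) (t : T) :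
    vectorForm φ ω ξ η (s ⊗ₜ t) = ∑ ρ, ∑ σ, φ s ρ σ * ⟪ξ ρ, ω t (η σ)⟫_ℂ :=
  rfl

/-- The matrix coefficient depends only on the compression to the span of an orthonormal family
that contains the vectors. -/
theorem sum_tensorState_eq_vectorForm {r m : ℕ} (φ : S →ₗ[ℂ] Matrix (Fin r) (Fin r) ℂ)
    (ω : T →ₗ[ℂ] K →L[ℂ] K) (e : Fin m → K) {ξ η : Fin r → K}
    (hξ : ∀ ρ, ξ ρ = ∑ a, ⟪e a, ξ ρ⟫_ℂ • e a) (hη : ∀ ρ, η ρ = ∑ a, ⟪e a, η ρ⟫_ℂ • e a)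
    (z : S ⊗[ℂ] T) :
    ∑ p : Fin r × Fin m, ∑ q : Fin r × Fin m,
      star ⟪e p.2, ξ p.1⟫_ℂ * tensorState φ (compression e ∘ₗ ω) z p q * ⟪e q.2, η q.1⟫_ℂ =
      vectorForm φ ω ξ η z := by
  induction z using TensorProduct.induction_on with
  | zero => simp
  | add z z' h h' =>
    simp only [map_add, Matrix.add_apply, mul_add, add_mul, Finset.sum_add_distrib, h, h']
  | tmul s t =>
    simp only [tensorState_tmul, vectorForm_tmul, Fintype.sum_prod_type]
    refine Finset.sum_congr rfl fun ρ _ => ?_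
    rw [Finset.sum_comm]
    refine Finset.sum_congr rfl fun σ _ => ?_
    conv_rhs => rw [hξ ρ, hη σ]
    simp only [map_sum, map_smul, sum_inner, inner_sum, inner_smul_left, inner_smul_right,
      Finset.mul_sum]
    rw [Finset.sum_comm]
    refine Finset.sum_congr rfl fun b _ => Finset.sum_congr rfl fun a _ => ?_
    simp only [compression, LinearMap.comp_apply, LinearMap.coe_mk, AddHom.coe_mk, Matrix.of_apply,
      RCLike.star_def]
    ring

variable [StarAddMonoid S] [StarModule ℂ S] [OperatorSystem S] [StarAddMonoid T] [StarModule ℂ T]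
  [OperatorSystem T]

/-- Elements of the minimal cone are positive as operators on `ℂ^r ⊗ K`. -/
theorem vectorForm_nonneg [CompleteSpace K] {ι : Type} [Fintype ι] {X : Matrix ι ι (S ⊗[ℂ] T)}
    (hX : X ∈ minCone S T ι) {r : ℕ} {φ : S →ₗ[ℂ] Matrix (Fin r) (Fin r) ℂ} (hφ : IsUCP φ)
    {ω : T →ₗ[ℂ] K →L[ℂ] K} (hω : IsUCP ω) (ξ : ι → Fin r → K) :
    0 ≤ ∑ i, ∑ j, vectorForm φ ω (ξ i) (ξ j) (X i j) := by
  -- compress to the span of the finitely many vectors, which gives a matrix state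
  obtain ⟨m, e, heo, he⟩ := exists_orthonormal_expansion
    (Set.range fun p : ι × Fin r => ξ p.1 p.2) (Set.finite_range _)
  have he' : ∀ i ρ, ξ i ρ = ∑ a, ⟪e a, ξ i ρ⟫_ℂ • e a := fun i ρ => he _ ⟨(i, ρ), rfl⟩
  have h := (mem_cone_complex_iff.1 (hX.2 r m φ _ hφ
    ((isUCP_compression heo).comp hω))).dotProduct_mulVec_nonneg
      fun p : ι × Fin r × Fin m => ⟪e p.2.2, ξ p.1 p.2.1⟫_ℂ
  convert h using 1
  simp only [← fun i j => sum_tensorState_eq_vectorForm φ ω e (he' i) (he' j), dotProduct,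
    Matrix.mulVec, Matrix.comp_apply, Matrix.map_apply, Pi.star_apply, Finset.mul_sum,
    Fintype.sum_prod_type (α₁ := ι)]
  refine Finset.sum_congr rfl fun i _ => ?_
  rw [Finset.sum_comm]
  refine Finset.sum_congr rfl fun p _ => Finset.sum_congr rfl fun j _ =>
    Finset.sum_congr rfl fun q _ => ?_
  ring

end VectorForms

/-! ### Units and submatrices in operator systems -/

section OperatorSystems

variable {S : Type*} [AddCommGroup S] [Module ℂ S] [StarAddMonoid S] [StarModule ℂ S]
  [OperatorSystem S]

theorem unit_mem_cone (S : Type*) [AddCommGroup S] [Module ℂ S] [StarAddMonoid S] [StarModule ℂ S]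
    [OperatorSystem S] (ι : Type) [Fintype ι] [DecidableEq ι] :
    (Matrix.diagonal fun _ => OperatorSystem.unit) ∈ OperatorSystem.cone (S := S) ι := by
  obtain ⟨r, hr, h⟩ := OperatorSystem.order_unit (0 : Matrix ι ι S) (by simp)
  have := OperatorSystem.smul_mem (inv_nonneg.2 hr.le) h
  rwa [zero_add, smul_smul, ← Complex.ofReal_mul, inv_mul_cancel₀ hr.ne', Complex.ofReal_one,
    one_smul] at this

theorem submatrix_mem_cone {ι κ : Type} [Fintype ι] [Fintype κ] {X : Matrix ι ι S}
    (hX : X ∈ OperatorSystem.cone ι) (f : κ → ι) :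
    X.submatrix f f ∈ OperatorSystem.cone κ := by
  classical
  convert OperatorSystem.conj_mem (Matrix.of fun i k => if i = f k then (1 : ℂ) else 0) hX using 1
  ext i j
  simp [scalarConj, apply_ite star]

end OperatorSystems

/-! ### Property `V` of the operators on a Hilbert space -/

section PositiveMatrix

open scoped InnerProductSpace ComplexOrder

variable {H : Type*} [NormedAddCommGroup H] [InnerProductSpace ℂ H] [CompleteSpace H]
  {p : Type} [Fintype p] [DecidableEq p] {n : ℕ}

/-- The extension theorem for positive pencils with coefficients in `M_p(B(H)) = B(H^p)`. -/
theorem IsPositivePencil.exists_mem_cone {S₀ : Matrix p p (H →L[ℂ] H)}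
    {B C : Fin n → Fin n → Matrix p p (H →L[ℂ] H)}
    (h : IsPositivePencil.{u} (ofBlocks S₀) (fun i j => ofBlocks (B i j))
      fun i j => ofBlocks (C i j)) (hn : 1 ≤ n) :
    ∃ R : Matrix (Fin n ⊕ Fin n) (Fin n ⊕ Fin n) (Matrix p p (H →L[ℂ] H)),
      R ∈ OperatorSystem.cone (Fin n ⊕ Fin n) ∧
      (∀ i j, R (Sum.inl i) (Sum.inr j) = B i j) ∧
      (∀ i j, R (Sum.inr i) (Sum.inl j) = C i j) ∧
      ∑ k, R k k = (2 * n : ℂ) • S₀ := by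
  obtain ⟨T, hT, hB, hC, hS⟩ := h.exists_matrix hn
  refine ⟨Matrix.of fun k l => Matrix.of fun s t => blockEntry (blockEntry T k l) s t,
    ?_, fun i j => ?_, fun i j => ?_, ?_⟩
  · refine mem_cone_operator_iff.2 fun v => ?_
    let w : BlockSpace (PiLp 2 fun _ : p => H) n :=
      WithLp.toLp 2 fun k => WithLp.toLp 2 fun s => v (k, s)
    convert hT w using 1
    rw [← sum_inner_blockEntry]
    simp only [← sum_inner_blockEntry (blockEntry T _ _), Fintype.sum_prod_type]
    refine Finset.sum_congr rfl fun k _ => ?_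
    rw [Finset.sum_comm]
    rfl
  · ext1 s t
    rw [Matrix.of_apply, Matrix.of_apply, hB, blockEntry_ofBlocks]
  · ext1 s t
    rw [Matrix.of_apply, Matrix.of_apply, hC, blockEntry_ofBlocks]
  · ext1 s t
    have h1 : blockEntry (∑ k, blockEntry T k k) s t = (2 * n : ℂ) • S₀ s t := by
      rw [hS, ← blockEntry_ofBlocks S₀ s t]
      rfl
    rw [Matrix.smul_apply, ← h1, Matrix.sum_apply]
    ext x
    simp [blockEntry_apply]

theorem sum_one_mul {r : ℕ} (f : Fin r → Fin r → ℂ) :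
    ∑ ρ, ∑ σ, (1 : Matrix (Fin r) (Fin r) ℂ) ρ σ * f ρ σ = ∑ ρ, f ρ ρ := by
  simp [Matrix.one_apply]

/-- The positive operator matrix exists already without the perturbation by `ε`. -/
theorem hasPropertyV_operators (H : Type u) [NormedAddCommGroup H] [InnerProductSpace ℂ H]
    [CompleteSpace H] : HasPropertyV.{u} (H →L[ℂ] H) := by
  intro n hn p S₀ B C hX ε hε
  have hpos : IsPositivePencil.{u} (ofBlocks S₀) (fun i j => ofBlocks (B i j))
      fun i j => ofBlocks (C i j) := by
    intro r φ hφ ξ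
    have h := vectorForm_nonneg hX hφ (isUCP_ofBlocks (Fin p) H) fun _ => ξ
    have h1 : φ 1 = 1 := hφ.1.trans Matrix.diagonal_one
    simpa only [Finset.univ_unique, Finset.sum_singleton, Matrix.of_apply, map_add, map_sum,
      vectorForm_tmul, h1, sum_one_mul, map_smul, ← TensorProduct.smul_tmul', smul_eq_mul,
      ofBlocksₗ_apply] using h
  obtain ⟨R, hR, hB, hC, hS⟩ := hpos.exists_mem_cone hn
  refine ⟨R + (ε : ℂ) • Matrix.diagonal fun _ => OperatorSystem.unit,
    OperatorSystem.add_mem hR (OperatorSystem.smul_mem hε.le (unit_mem_cone _ _)),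
    fun i j => ?_, fun i j => ?_, ?_⟩
  · simp [hB]
  · simp [hC]
  · simp only [Matrix.add_apply, Finset.sum_add_distrib, hS, Matrix.smul_apply,
      Matrix.diagonal_apply_eq, Finset.sum_const, Finset.card_univ, Fintype.card_sum,
      Fintype.card_fin, smul_add]
    rw [← Nat.cast_smul_eq_nsmul ℂ]
    push_cast
    rw [two_mul]

end PositiveMatrix

/-! ### The maximal cone is contained in the minimal cone -/

section MinMax

variable {S : Type*} [AddCommGroup S] [Module ℂ S] [StarAddMonoid S] [StarModule ℂ S]
  [OperatorSystem S]
  {T : Type*} [AddCommGroup T] [Module ℂ T] [StarAddMonoid T] [StarModule ℂ T]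
  [OperatorSystem T]

theorem tensorState_unit {r q : ℕ} {φ : S →ₗ[ℂ] Matrix (Fin r) (Fin r) ℂ}
    {ψ : T →ₗ[ℂ] Matrix (Fin q) (Fin q) ℂ} (hφ : IsUCP φ) (hψ : IsUCP ψ) :
    tensorState φ ψ (OperatorSystem.unit ⊗ₜ OperatorSystem.unit) = OperatorSystem.unit := by
  ext a b
  rw [tensorState_tmul, hφ.1, hψ.1]
  change Matrix.diagonal (fun _ => (1 : ℂ)) a.1 b.1 * Matrix.diagonal (fun _ => (1 : ℂ)) a.2 b.2 =
    Matrix.diagonal (fun _ => (1 : ℂ)) a b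
  simp only [Matrix.diagonal_apply, Prod.ext_iff]
  split_ifs <;> simp_all

theorem map_add_unit {ι : Type} [Fintype ι] [DecidableEq ι] {r q : ℕ}
    {φ : S →ₗ[ℂ] Matrix (Fin r) (Fin r) ℂ} {ψ : T →ₗ[ℂ] Matrix (Fin q) (Fin q) ℂ}
    (hφ : IsUCP φ) (hψ : IsUCP ψ) (X : Matrix ι ι (S ⊗[ℂ] T)) (ε : ℝ) :
    (X + (ε : ℂ) • Matrix.diagonal (fun _ =>
      (OperatorSystem.unit : S) ⊗ₜ[ℂ] (OperatorSystem.unit : T))).map (tensorState φ ψ) =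
    X.map (tensorState φ ψ) + (ε : ℂ) • Matrix.diagonal fun _ => OperatorSystem.unit := by
  ext1 i j
  by_cases h : i = j <;> simp [h, tensorState_unit hφ hψ]

theorem isHermitian_add_unit {ι : Type} [Fintype ι] [DecidableEq ι] {X : Matrix ι ι (S ⊗[ℂ] T)}
    (hX : Xᴴ = X) (ε : ℝ) :
    (X + (ε : ℂ) • Matrix.diagonal (fun _ =>
      (OperatorSystem.unit : S) ⊗ₜ[ℂ] (OperatorSystem.unit : T)))ᴴ = X + (ε : ℂ) •
        Matrix.diagonal (fun _ => (OperatorSystem.unit : S) ⊗ₜ[ℂ] (OperatorSystem.unit : T)) := by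
  rw [Matrix.conjTranspose_add, hX, Matrix.conjTranspose_smul, Matrix.diagonal_conjTranspose]
  congr 2
  · simp
  · congr 1
    ext
    simp [OperatorSystem.star_unit]

theorem minCone_add_unit {ι : Type} [Fintype ι] [DecidableEq ι] {X : Matrix ι ι (S ⊗[ℂ] T)}
    (hX : X ∈ minCone S T ι) {ε : ℝ} (hε : 0 ≤ ε) :
    X + (ε : ℂ) • Matrix.diagonal (fun _ =>
      (OperatorSystem.unit : S) ⊗ₜ[ℂ] (OperatorSystem.unit : T)) ∈ minCone S T ι := by
  refine ⟨isHermitian_add_unit hX.1 ε, fun r q φ ψ hφ hψ => ?_⟩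
  rw [map_add_unit hφ hψ]
  exact OperatorSystem.add_mem (hX.2 r q φ ψ hφ hψ)
    (OperatorSystem.smul_mem hε (unit_mem_cone _ _))

open scoped ComplexOrder Kronecker in
/-- A tensor product of positive matrices is positive in the minimal tensor product, by positivity
of Kronecker products. -/
theorem matrixTensor_map_mem_cone {k m r q : ℕ} {P : Matrix (Fin k) (Fin k) S}
    {Q : Matrix (Fin m) (Fin m) T} (hP : P ∈ OperatorSystem.cone (Fin k))
    (hQ : Q ∈ OperatorSystem.cone (Fin m))
    {φ : S →ₗ[ℂ] Matrix (Fin r) (Fin r) ℂ} {ψ : T →ₗ[ℂ] Matrix (Fin q) (Fin q) ℂ}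
    (hφ : IsUCP φ) (hψ : IsUCP ψ) :
    (matrixTensor P Q).map (tensorState φ ψ) ∈ OperatorSystem.cone (Fin k × Fin m) := by
  have h1 := mem_cone_complex_iff.1 (hφ.2 _ _ hP)
  have h2 := mem_cone_complex_iff.1 (hψ.2 _ _ hQ)
  exact mem_cone_complex_iff.2 ((h1.kronecker h2).submatrix
    fun x : (Fin k × Fin m) × Fin r × Fin q => ((x.1.1, x.2.1), (x.1.2, x.2.2)))

theorem maxCone_subset_minCone (ι : Type) [Fintype ι] : maxCone S T ι ⊆ minCone S T ι := by
  classical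
  rintro X ⟨hX, h⟩
  refine ⟨hX, fun r q φ ψ hφ hψ => ?_⟩
  have key : ∀ ε : ℝ, 0 < ε → X.map (tensorState φ ψ) +
      (ε : ℂ) • Matrix.diagonal (fun _ => OperatorSystem.unit) ∈ OperatorSystem.cone ι := by
    intro ε hε
    obtain ⟨-, k, m, P, Q, A, hP, hQ, he⟩ := h ε hε
    rw [← map_add_unit hφ hψ]
    convert OperatorSystem.conj_mem Aᴴ (matrixTensor_map_mem_cone hP hQ hφ hψ) using 1
    have he' : X + (ε : ℂ) • Matrix.diagonal (fun _ =>
      (OperatorSystem.unit : S) ⊗ₜ[ℂ] (OperatorSystem.unit : T)) =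
        scalarConj Aᴴ (matrixTensor P Q) := by
      rw [← he]
    rw [he']
    ext1 i j
    simp [scalarConj]
  -- self-adjointness of the image follows from that of its perturbation
  refine OperatorSystem.archimedean _ ?_ key
  have h1 := OperatorSystem.isHermitian (key 1 one_pos)
  have h2 := OperatorSystem.isHermitian
    (unit_mem_cone (Matrix (Fin r × Fin q) (Fin r × Fin q) ℂ) ι)
  rw [Complex.ofReal_one, one_smul, Matrix.conjTranspose_add, h2] at h1
  exact add_right_cancel h1

end MinMax

/-! ### Elements of the maximal cone -/

section MaximalCone

variable {S : Type*} [AddCommGroup S] [Module ℂ S] [StarAddMonoid S] [StarModule ℂ S]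
  [OperatorSystem S]
  {T : Type*} [AddCommGroup T] [Module ℂ T] [StarAddMonoid T] [StarModule ℂ T]
  [OperatorSystem T]

/-- The factorizations in the definition of the maximal cone may use matrices over arbitrary
finite index types. -/
theorem mem_maxPreCone_of_eq {ι κ κ' : Type} [Fintype ι] [Fintype κ] [Fintype κ']
    {X : Matrix ι ι (S ⊗[ℂ] T)} (hX : Xᴴ = X) {P : Matrix κ κ S} {Q : Matrix κ' κ' T}
    (hP : P ∈ OperatorSystem.cone κ) (hQ : Q ∈ OperatorSystem.cone κ') (A : ι → κ → κ' → ℂ)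
    (h : ∀ s t, X s t = ∑ a, ∑ b, ∑ c, ∑ d, (A s a c * star (A t b d)) • P a b ⊗ₜ[ℂ] Q c d) :
    X ∈ maxPreCone S T ι := by
  classical
  let e := (Fintype.equivFin κ).symm
  let e' := (Fintype.equivFin κ').symm
  refine ⟨hX, _, _, P.submatrix e e, Q.submatrix e' e', Matrix.of fun s x => A s (e x.1) (e' x.2),
    submatrix_mem_cone hP e, submatrix_mem_cone hQ e', ?_⟩
  ext1 s t
  rw [h]
  simp only [scalarConj, matrixTensor, Matrix.of_apply, Matrix.conjTranspose_apply, star_star,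
    Fintype.sum_prod_type, Matrix.submatrix_apply]
  rw [← e.sum_comp]
  refine Finset.sum_congr rfl fun a _ => ?_
  rw [Finset.sum_comm' (t' := Finset.univ) (s' := fun _ => Finset.univ) (by simp),
    ← e'.sum_comp]
  refine Finset.sum_congr rfl fun c _ => ?_
  rw [← e.sum_comp]
  exact Finset.sum_congr rfl fun b _ => (e'.sum_comp _).symm

/-- The partial contraction `c ∑ P k l ⊗ R k l` of positive block matrices `P` and `R` lies in the
maximal cone. -/
theorem mem_maxPreCone_of_sum_tmul {ι κ : Type} [Fintype ι] [DecidableEq ι] [Fintype κ]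
    {X : Matrix ι ι (S ⊗[ℂ] T)} (hX : Xᴴ = X) {P : Matrix κ κ S} {R : Matrix κ κ (Matrix ι ι T)}
    (hP : P ∈ OperatorSystem.cone κ) (hR : R ∈ OperatorSystem.cone κ) {c : ℝ} (hc : 0 ≤ c)
    (h : ∀ s t, X s t = (c : ℂ) • ∑ k, ∑ l, P k l ⊗ₜ[ℂ] R k l s t) :
    X ∈ maxPreCone S T ι := by
  classical
  have hr : ((√c : ℝ) : ℂ) * star ((√c : ℝ) : ℂ) = c := by
    rw [RCLike.star_def, Complex.conj_ofReal, ← Complex.ofReal_mul, Real.mul_self_sqrt hc]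
  -- `R` is a matrix indexed by `κ × ι`; the scalar matrix selects the pairs `(k, (k, s))`
  refine mem_maxPreCone_of_eq hX hP (Q := Matrix.comp _ _ _ _ _ R) hR
    (fun s k x => if x = (k, s) then ((√c : ℝ) : ℂ) else 0) fun s t => ?_
  simp only [h, Finset.smul_sum]
  refine Finset.sum_congr rfl fun k _ => Finset.sum_congr rfl fun l _ => ?_
  rw [Finset.sum_eq_single (k, s), Finset.sum_eq_single (l, t)]
  · rw [if_pos rfl, if_pos rfl, hr]
    rfl
  · intro y _ hy
    simp [hy]
  · simp
  · intro y _ hy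
    simp [hy]
  · simp

end MaximalCone

/-! ### Elements of `V_n ⊗ T` -/

section Pencils

variable {V T : Type*} [AddCommGroup V] [Module ℂ V] [AddCommGroup T] [Module ℂ T] {n : ℕ}

/-- The element `e ⊗ s + (1/2n) ∑ g i j ⊗ b i j + (1/2n) ∑ g' i j ⊗ c i j` of `V ⊗ T`. -/
def tensorPencil (e : V) (g g' : Matrix (Fin n) (Fin n) V) (s : T) (b c : Fin n → Fin n → T) :
    V ⊗[ℂ] T :=
  e ⊗ₜ[ℂ] s + (1 / (2 * n) : ℂ) • ∑ i, ∑ j, g i j ⊗ₜ[ℂ] b i j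
    + (1 / (2 * n) : ℂ) • ∑ i, ∑ j, g' i j ⊗ₜ[ℂ] c i j

theorem tensorPencil_add (e : V) (g g' : Matrix (Fin n) (Fin n) V) (s s' : T)
    (b b' c c' : Fin n → Fin n → T) :
    tensorPencil e g g' (s + s') (b + b') (c + c') =
      tensorPencil e g g' s b c + tensorPencil e g g' s' b' c' := by
  simp only [tensorPencil, Pi.add_apply, TensorProduct.tmul_add, Finset.sum_add_distrib, smul_add]
  abel

theorem tensorPencil_zero (e : V) (g g' : Matrix (Fin n) (Fin n) V) :
    tensorPencil e g g' (0 : T) 0 0 = 0 := by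
  simp [tensorPencil]

theorem sum_sum_tmul_single (g : Matrix (Fin n) (Fin n) V) (k l : Fin n) (t : T) :
    ∑ i, ∑ j, g i j ⊗ₜ[ℂ] (if i = k ∧ j = l then t else 0) = g k l ⊗ₜ[ℂ] t := by
  rw [Finset.sum_eq_single k, Finset.sum_eq_single l]
  · simp
  · intro j _ hj
    simp [hj]
  · simp
  · intro i _ hi
    simp [hi]
  · simp

theorem two_mul_natCast_ne_zero (hn : 1 ≤ n) : (2 * n : ℂ) ≠ 0 :=
  mul_ne_zero two_ne_zero (Nat.cast_ne_zero.2 (by omega))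

/-- If `e`, the `g i j` and the `g' i j` span `V`, then every element of `V ⊗ T` is a pencil. -/
theorem exists_eq_tensorPencil (hn : 1 ≤ n) {e : V} {g g' : Matrix (Fin n) (Fin n) V}
    (hV : Submodule.span ℂ ({e} ∪ (Set.range fun p : Fin n × Fin n => g p.1 p.2) ∪
      Set.range fun p : Fin n × Fin n => g' p.2 p.1) = ⊤) (z : V ⊗[ℂ] T) :
    ∃ s b c, z = tensorPencil e g g' s b c := by
  have hn' := two_mul_natCast_ne_zero hn
  have key : ∀ v : V, ∀ t : T, ∃ s b c, v ⊗ₜ[ℂ] t = tensorPencil e g g' s b c := by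
    intro v
    have hv : v ∈ (⊤ : Submodule ℂ V) := trivial
    rw [← hV] at hv
    induction hv using Submodule.span_induction with
    | mem v h =>
      intro t
      rcases h with (rfl | ⟨p, rfl⟩) | ⟨p, rfl⟩
      · exact ⟨t, 0, 0, by simp [tensorPencil]⟩
      · refine ⟨0, fun i j => if i = p.1 ∧ j = p.2 then (2 * n : ℂ) • t else 0, 0, ?_⟩
        rw [tensorPencil, sum_sum_tmul_single, TensorProduct.tmul_smul, smul_smul, one_div,
          inv_mul_cancel₀ hn', one_smul]
        simp
      · refine ⟨0, 0, fun i j => if i = p.2 ∧ j = p.1 then (2 * n : ℂ) • t else 0, ?_⟩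
        rw [tensorPencil, sum_sum_tmul_single, TensorProduct.tmul_smul, smul_smul, one_div,
          inv_mul_cancel₀ hn', one_smul]
        simp
    | zero => exact fun t => ⟨0, 0, 0, by rw [tensorPencil_zero, TensorProduct.zero_tmul]⟩
    | add v v' _ _ h h' =>
      intro t
      obtain ⟨s, b, c, e⟩ := h t
      obtain ⟨s', b', c', e'⟩ := h' t
      exact ⟨s + s', b + b', c + c', by rw [TensorProduct.add_tmul, e, e', tensorPencil_add]⟩
    | smul a v _ h =>
      intro t
      obtain ⟨s, b, c, e⟩ := h (a • t)
      exact ⟨s, b, c, by rw [TensorProduct.smul_tmul, e]⟩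
  induction z using TensorProduct.induction_on with
  | zero => exact ⟨0, 0, 0, (tensorPencil_zero _ _ _).symm⟩
  | tmul v t => exact key v t
  | add z z' h h' =>
    obtain ⟨s, b, c, e⟩ := h
    obtain ⟨s', b', c', e'⟩ := h'
    exact ⟨s + s', b + b', c + c', by rw [e, e', tensorPencil_add]⟩

/-- Pairing the block matrix `[e, g; g', e]` with `R` gives the pencil with the off-diagonal blocks
of `R` and the mean of its diagonal blocks as coefficients. -/
theorem sum_fromBlocks_tmul (hn : 1 ≤ n) (e : V) (g g' : Matrix (Fin n) (Fin n) V) {s : T}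
    {b c : Fin n → Fin n → T} {R : Matrix (Fin n ⊕ Fin n) (Fin n ⊕ Fin n) T}
    (hb : ∀ i j, R (Sum.inl i) (Sum.inr j) = b i j)
    (hc : ∀ i j, R (Sum.inr i) (Sum.inl j) = c i j) (hs : ∑ k, R k k = (2 * n : ℂ) • s) :
    (1 / (2 * n) : ℂ) • ∑ k, ∑ l, Matrix.fromBlocks (Matrix.diagonal fun _ => e) g g'
      (Matrix.diagonal fun _ => e) k l ⊗ₜ[ℂ] R k l = tensorPencil e g g' s b c := by
  have hs' : s = (1 / (2 * n) : ℂ) •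
      (∑ i : Fin n, R (Sum.inl i) (Sum.inl i) + ∑ i : Fin n, R (Sum.inr i) (Sum.inr i)) := by
    rw [← Fintype.sum_sum_type (f := fun k => R k k), hs, smul_smul, one_div,
      inv_mul_cancel₀ (two_mul_natCast_ne_zero hn), one_smul]
  have hd : ∀ f : Fin n → Fin n → T,
      ∑ i, ∑ j, Matrix.diagonal (fun _ => e) i j ⊗ₜ[ℂ] f i j = e ⊗ₜ[ℂ] ∑ i, f i i := by
    intro f
    rw [TensorProduct.tmul_sum]
    refine Finset.sum_congr rfl fun i _ => ?_
    rw [Finset.sum_eq_single i]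
    · simp
    · intro j _ hj
      simp [Ne.symm hj]
    · simp
  simp only [Fintype.sum_sum_type, Matrix.fromBlocks_apply₁₁, Matrix.fromBlocks_apply₁₂,
    Matrix.fromBlocks_apply₂₁, Matrix.fromBlocks_apply₂₂, Finset.sum_add_distrib, hb, hc]
  rw [hd fun i j => R (Sum.inl i) (Sum.inl j), hd fun i j => R (Sum.inr i) (Sum.inr j),
    tensorPencil, hs', TensorProduct.tmul_smul, TensorProduct.tmul_add]
  simp only [smul_add]
  abel

/-- The element `1 ⊗ s + (1/2n) ∑ u_{ij} ⊗ b i j + (1/2n) ∑ u_{ji}^* ⊗ c i j` of `V_n ⊗ T`. -/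
def Vsys.pencil (s : T) (b c : Fin n → Fin n → T) : Vsys.{u} n ⊗[ℂ] T :=
  tensorPencil OperatorSystem.unit (Vsys.gen.{u} n) (Vsys.gen.{u} n)ᴴ s b c

theorem Vsys.exists_eq_pencil (hn : 1 ≤ n) (z : Vsys.{u} n ⊗[ℂ] T) :
    ∃ s b c, z = Vsys.pencil s b c := by
  refine exists_eq_tensorPencil hn ?_ z
  exact Vsys.span_eq_top n

end Pencils

/-! ### The minimal and the maximal tensor product of `V_n` and `B(H)` -/

section MinEqualsMax

open scoped InnerProductSpace ComplexOrder

variable {H : Type*} [NormedAddCommGroup H] [InnerProductSpace ℂ H] [CompleteSpace H]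
  {ι : Type} [Fintype ι] {n : ℕ}

theorem isUCP_id : IsUCP (LinearMap.id : (H →L[ℂ] H) →ₗ[ℂ] H →L[ℂ] H) :=
  ⟨rfl, fun _ _ _ hX => hX⟩

/-- The coefficients of an element of `M_ι(V_n ⊗ B(H))` are operators on `H^ι`, and they form a
positive pencil if the element is in the minimal cone. -/
theorem isPositivePencil_of_mem_minCone {S₀ : Matrix ι ι (H →L[ℂ] H)}
    {B C : Fin n → Fin n → Matrix ι ι (H →L[ℂ] H)}
    (hX : (Matrix.of fun s t => Vsys.pencil.{u} (S₀ s t) (fun i j => B i j s t)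
      fun i j => C i j s t) ∈ minCone (Vsys.{u} n) (H →L[ℂ] H) ι) :
    IsPositivePencil.{u} (ofBlocks S₀) (fun i j => ofBlocks (B i j))
      fun i j => ofBlocks (C i j) := by
  classical
  intro r φ hφ ξ
  have hφ' : IsUCP (φ ∘ₗ (Vsys.{u} n).toSubmodule.subtype) :=
    ⟨hφ.1, fun κ _ X hX => hφ.2 κ _ hX⟩
  have h := vectorForm_nonneg hX hφ' isUCP_id fun s ρ => ξ ρ s
  have h1 : (φ ∘ₗ (Vsys.{u} n).toSubmodule.subtype) OperatorSystem.unit = 1 :=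
    hφ'.1.trans Matrix.diagonal_one
  have hg : ∀ i j, (φ ∘ₗ (Vsys.{u} n).toSubmodule.subtype) (Vsys.gen n i j) =
    φ (Unc.gen n i j) := fun _ _ => rfl
  have hg' : ∀ i j, (φ ∘ₗ (Vsys.{u} n).toSubmodule.subtype) (star (Vsys.gen n i j)) =
    φ (star (Unc.gen n i j)) := fun _ _ => rfl
  have hsum : ∀ (g : Fin n → Fin n → Matrix (Fin r) (Fin r) ℂ)
      (B : Fin n → Fin n → Matrix ι ι (H →L[ℂ] H)),
      ∑ s, ∑ t, (1 / (2 * n) : ℂ) * ∑ i, ∑ j,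
        ∑ ρ, ∑ σ, g i j ρ σ * ⟪ξ ρ s, B i j s t (ξ σ t)⟫_ℂ =
      ∑ i, ∑ j, (1 / (2 * n) : ℂ) *
        ∑ ρ, ∑ σ, g i j ρ σ * ⟪ξ ρ, ofBlocks (B i j) (ξ σ)⟫_ℂ := by
    intro g B
    simp only [← Finset.mul_sum, inner_ofBlocks]
    rw [sum_comm_pairs]
    congr 1
    refine Finset.sum_congr rfl fun i _ => Finset.sum_congr rfl fun j _ => ?_
    rw [sum_comm_pairs]
    simp only [Finset.mul_sum]
  simp only [Matrix.of_apply, Vsys.pencil, tensorPencil, map_add, map_sum, vectorForm_tmul, h1,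
    sum_one_mul, map_smul, smul_eq_mul, LinearMap.id_apply, Matrix.conjTranspose_apply, hg, hg',
    Finset.sum_add_distrib, hsum _ B, hsum (fun i j => φ (star (Unc.gen n j i))) C] at h
  convert h using 3
  simp only [inner_ofBlocks]
  rw [Finset.sum_comm]
  exact Finset.sum_congr rfl fun s _ => Finset.sum_comm

/-- Over the operators on a Hilbert space, elements of the minimal cone are elementary
compressions `A (P ⊗ R) A^*` with `P` the block matrix of the universal unitary. -/
theorem minCone_subset_maxPreCone (hn : 1 ≤ n) :
    minCone (Vsys.{u} n) (H →L[ℂ] H) ι ⊆ maxPreCone (Vsys.{u} n) (H →L[ℂ] H) ι := by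
  classical
  intro X hX
  choose S₀ B C hz using fun s t => Vsys.exists_eq_pencil hn (X s t)
  have hpos := isPositivePencil_of_mem_minCone (S₀ := Matrix.of S₀)
    (B := fun i j => Matrix.of fun s t => B s t i j)
    (C := fun i j => Matrix.of fun s t => C s t i j) (Set.mem_of_eq_of_mem (by
      ext1 s t
      exact (hz s t).symm) hX)
  obtain ⟨R, hR, hB, hC, hS⟩ := hpos.exists_mem_cone hn
  refine mem_maxPreCone_of_sum_tmul hX.1 (Vsys.fromBlocks_gen_mem_cone.{u} n) hR
    (c := 1 / (2 * n)) (by positivity) fun s t => ?_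
  rw [hz, Vsys.pencil, ← sum_fromBlocks_tmul hn _ _ _ (R := Matrix.of fun k l => R k l s t)
    (b := B s t) (c := C s t) (fun i j => congrFun (congrFun (hB i j) s) t)
    (fun i j => congrFun (congrFun (hC i j) s) t)
    (by simpa [Matrix.sum_apply] using congrFun (congrFun hS s) t)]
  push_cast
  rfl

theorem minEqMax_Vsys (hn : 1 ≤ n) : MinEqMax (Vsys.{u} n) (H →L[ℂ] H) := by
  intro ι _
  refine Set.Subset.antisymm (fun X hX => ⟨hX.1, fun ε hε => ?_⟩) (maxCone_subset_minCone ι)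
  classical
  convert minCone_subset_maxPreCone hn (minCone_add_unit hX hε.le)

end MinEqualsMax

end

theorem mainTheorem4 :
    (∀ (H : Type u) [NormedAddCommGroup H] [InnerProductSpace ℂ H] [CompleteSpace H],
      HasPropertyV.{u} (H →L[ℂ] H)) ∧
    (∀ (n : ℕ), 1 ≤ n →
      ∀ (H : Type u) [NormedAddCommGroup H] [InnerProductSpace ℂ H] [CompleteSpace H],
        MinEqMax (Vsys.{u} n) (H →L[ℂ] H)) ∧
    (∀ (n : ℕ), 2 ≤ n → HasOSLLP.{u} (Vsys.{u} n)) :=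
  ⟨fun H => hasPropertyV_operators H, fun _ hn _ => minEqMax_Vsys hn, fun n _ => hasOSLLP_Vsys n⟩
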